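/- **Setting.** Let $\bar{\mathcal X}$ be a measurable space of natural samples, $\mathcal P$ (all data) and $\mathcal P_l$ (labeled data, one labeled class) probability measures on it, and let $\mathcal T(\cdot\mid\bar x)$, $\bar x\in\bar{\mathcal X}$, be a Markov kernel to the set $\{1,\dots,N\}$ of augmented samples. Put $A^{(u)}_{xx'}=\mathbb E_{\bar x\sim\mathcal P}\,\mathcal T(x|\bar x)\mathcal T(x'|\bar x)$, $\mathfrak l_x=\mathbb E_{\bar x\sim\mathcal P_l}\mathcal T(x|\bar x)$ and $A(\delta)=\eta_uA^{(u)}+\delta\,\mathfrak l\mathfrak l^\top$, where the unlabeled graph is normalized to equal degrees: every row sum of $A(0)=\eta_uA^{(u)}$ is $1$. Let $D(\delta)$ be the diagonal matrix of row sums of $A(\delta)$ and $\dot A(\delta)=D(\delta)^{-1/2}A(\delta)D(\delta)^{-1/2}$, a symmetric positive semidefinite matrix for $\delta\ge0$. For a singular value decomposition $\dot A(\delta)=\sum_{j=1}^N\lambda_j(\delta)v_j(\delta)v_j(\delta)^\top$ with $\lambda_1(\delta)\ge\dots\ge\lambda_N(\delta)\ge0$ and orthonormal $v_j(\delta)$,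 let $V_k(\delta)=[v_1(\delta),\dots,v_k(\delta)]$, $\Sigma_k(\delta)=\mathrm{diag}(\lambda_1(\delta),\dots,\lambda_k(\delta))$, and let $Z(\delta)=D(\delta)^{-1/2}V_k(\delta)\Sigma_k(\delta)^{1/2}\in\mathbb R^{N\times k}$ be the spectral representation, whose rows are the features $z_1,\dots,z_N$. Quantities at $\delta=0$ carry the superscript $(u)$, with $Z=Z(0)$. Let $V_\varnothing^{(u)}\in\mathbb R^{N\times(N-k)}$ have as columns an orthonormal basis of the null space of $V_k^{(u)\top}$, $\tilde A^{(u)}_k=V_k^{(u)}\Sigma_k^{(u)}V_k^{(u)\top}$, and $\mathcal G_k=\lambda_k^{(u)}/\lambda_{k+1}^{(u)}\in[1,\infty]$ (with $\lambda_{N+1}^{(u)}=0$, and $1/\mathcal G_k=0$ if $\lambda^{(u)}_{k+1}=0<\lambda^{(u)}_k$). Let $\Pi$ be a partition of $\{1,\dots,N\}$ into nonempty classes. With the class means $\mu_\pi=\frac1{|\pi|}\sum_{i\in\pi}z_i$ and the overall mean $\mu_\Pi=\frac1N\sum_iz_i$, put $$\mathcal M_{intra}(\Pi,Z)=\sum_{\pi\in\Pi}\sum_{i\in\pi}\|z_i-\mu_\pi\|^2,\qquad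 \mathcal M_{inter}(\Pi,Z)=\sum_{\pi\in\Pi}|\pi|\,\|\mu_\pi-\mu_\Pi\|^2,\qquad \mathcal M_{kms}=\mathcal M_{intra}/\mathcal M_{inter},$$ and $\Delta_{kms}(\delta)=\mathcal M_{kms}(\Pi,Z)-\mathcal M_{kms}(\Pi,Z(\delta))$. Let $\eta_1=1/\mathcal M_{inter}(\Pi,Z)$, $\eta_2=\mathcal M_{intra}(\Pi,Z)/\mathcal M_{inter}(\Pi,Z)$ and $\Upsilon=(1+\eta_2)H_\Pi-I-\frac{\eta_2}{N}\mathbf 1\mathbf 1^\top$, where $(H_\Pi)_{xx'}=1/|\pi|$ if $x,x'$ lie in the same class $\pi$ and $0$ otherwise. **Theorem.** For all $k\in\mathbb N$, $a>0$, $G_0>1$ and $B>0$ there are constants $C,\delta_0>0$, depending only on $k,a,G_0,B$, such that the following holds for all data as above (with any $N\ge k$) for which $\mathcal M_{inter}(\Pi,Z)>0$, $\eta_1\le B$, $\lambda_k^{(u)}\ge a$ and $\mathcal G_k\ge G_0$. 1. $\Upsilon$ encodes the ground-truth clustering: for $x\ne x'$ with the same label, $\Upsilon_{xx'}>0$; and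 if $\mathcal M_{intra}(\Pi,Z)>0$, then $\Upsilon_{xx'}<0$ for $x,x'$ with different labels. 2. For all $0<\delta\le\delta_0$ one has $\mathcal M_{inter}(\Pi,Z(\delta))>0$ and $$\left|\Delta_{kms}(\delta)-\delta\,\eta_1\operatorname{Tr}\!\left(\Upsilon\left(V_k^{(u)}V_k^{(u)\top}\mathfrak l\mathfrak l^\top\bigl(I+V_\varnothing^{(u)}V_\varnothing^{(u)\top}\bigr)-2\tilde A_k^{(u)}\,\mathrm{diag}(\mathfrak l)\right)\right)\right|\le C\left(\frac1{\mathcal G_k}+\delta^2\right).$$ -/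

import Mathlib

open MeasureTheory ProbabilityTheory
open scoped Matrix ENNReal

noncomputable section

namespace SORL

/-! ### The augmentation graph -/

/-- Self-supervised adjacency matrix `A⁽ᵘ⁾`: the entry at `(x, x')` is
`𝔼_{x̄ ∼ P} T(x | x̄) T(x' | x̄)`, where `T(· | x̄)` is the law of an augmentation of `x̄`. -/
def selfSupAdj {Xbar : Type*} [MeasurableSpace Xbar] {N : ℕ}
    (P : Measure Xbar) (T : Kernel Xbar (Fin N)) : Matrix (Fin N) (Fin N) ℝ :=
  Matrix.of fun x x' => ∫ xb, (T xb).real {x} * (T xb).real {x'} ∂P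

/-- The vector `𝔩` of semantic connections to the labeled data (one labeled class, with
distribution `Pl`): `𝔩_x = 𝔼_{x̄ ∼ Pl} T(x | x̄)`. -/
def labelVec {Xbar : Type*} [MeasurableSpace Xbar] {N : ℕ}
    (Pl : Measure Xbar) (T : Kernel Xbar (Fin N)) : Fin N → ℝ :=
  fun x => ∫ xb, (T xb).real {x} ∂Pl

/-- The perturbed adjacency matrix `A(δ) = η_u A⁽ᵘ⁾ + δ 𝔩 𝔩ᵀ`. -/
def adj {Xbar : Type*} [MeasurableSpace Xbar] {N : ℕ} (ηu : ℝ) (P Pl : Measure Xbar)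
    (T : Kernel Xbar (Fin N)) (δ : ℝ) : Matrix (Fin N) (Fin N) ℝ :=
  ηu • selfSupAdj P T + δ • Matrix.vecMulVec (labelVec Pl T) (labelVec Pl T)

/-- Degree of a vertex: row sum of the adjacency matrix. -/
def degree {N : ℕ} (A : Matrix (Fin N) (Fin N) ℝ) (x : Fin N) : ℝ := ∑ x', A x x'

/-- `D^{-1/2}`, with `D` the diagonal matrix of degrees. -/
def invSqrtDeg {N : ℕ} (A : Matrix (Fin N) (Fin N) ℝ) : Matrix (Fin N) (Fin N) ℝ :=
  Matrix.diagonal fun x => (Real.sqrt (degree A x))⁻¹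

/-- The normalized adjacency matrix `D^{-1/2} A D^{-1/2}`. -/
def normAdj {N : ℕ} (A : Matrix (Fin N) (Fin N) ℝ) : Matrix (Fin N) (Fin N) ℝ :=
  invSqrtDeg A * A * invSqrtDeg A

/-! ### Singular value decomposition and spectral representation -/

/-- `M = ∑ⱼ σⱼ vⱼ vⱼᵀ` is a singular value decomposition of the symmetric positive semidefinite
matrix `M`: the `vⱼ` (columns of `V`) are orthonormal and the `σⱼ` are nonnegative and listed in
nonincreasing order. -/
structure IsSVD {N : ℕ} (M V : Matrix (Fin N) (Fin N) ℝ) (σ : Fin N → ℝ) : Prop where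
  orthonormal : Vᵀ * V = 1
  nonneg : ∀ j, 0 ≤ σ j
  antitone : Antitone σ
  decomp : M = V * Matrix.diagonal σ * Vᵀ

/-- The `j`-th singular value `λ_j`, counted from `1`; there is none (value `0`) for `j = 0` and
for `j > N`. -/
def singVal {N : ℕ} (σ : Fin N → ℝ) (j : ℕ) : ℝ :=
  if h : 1 ≤ j ∧ j ≤ N then σ ⟨j - 1, by omega⟩ else 0

/-- The spectral gap `𝒢_k = λ_k / λ_{k+1}`; it is `∞` if `λ_k > 0 = λ_{k+1}`. -/
def spectralGap {N : ℕ} (σ : Fin N → ℝ) (k : ℕ) : ℝ≥0∞ :=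
  ENNReal.ofReal (singVal σ k) / ENNReal.ofReal (singVal σ (k + 1))

/-- `V_k`: the first `k` columns of `V`. -/
def topVec {N k : ℕ} (hk : k ≤ N) (V : Matrix (Fin N) (Fin N) ℝ) : Matrix (Fin N) (Fin k) ℝ :=
  V.submatrix id (Fin.castLE hk)

/-- The first `k` singular values, i.e. the diagonal of `Σ_k`. -/
def topVal {N k : ℕ} (hk : k ≤ N) (σ : Fin N → ℝ) : Fin k → ℝ := fun j => σ (Fin.castLE hk j)

/-- The rank-`k` approximation `V_k Σ_k V_kᵀ`. -/
def rankApprox {N k : ℕ} (hk : k ≤ N) (V : Matrix (Fin N) (Fin N) ℝ) (σ : Fin N → ℝ) :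
    Matrix (Fin N) (Fin N) ℝ :=
  topVec hk V * Matrix.diagonal (topVal hk σ) * (topVec hk V)ᵀ

/-- The representation `Z = D^{-1/2} V_k √Σ_k` computed from the graph `A`. -/
def rep {N k : ℕ} (hk : k ≤ N) (A V : Matrix (Fin N) (Fin N) ℝ) (σ : Fin N → ℝ) :
    Matrix (Fin N) (Fin k) ℝ :=
  invSqrtDeg A * topVec hk V * Matrix.diagonal fun j => Real.sqrt (topVal hk σ j)

/-- The columns of `W` are an orthonormal basis of the null space of `V_kᵀ`. -/
def IsNullBasis {N k : ℕ} (Vk : Matrix (Fin N) (Fin k) ℝ) (W : Matrix (Fin N) (Fin (N - k)) ℝ) :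
    Prop :=
  Wᵀ * W = 1 ∧ Vkᵀ * W = 0

/-! ### The K-means measure -/

/-- The average of the feature vectors (rows of `Z`) with index in `s`. -/
def center {N k : ℕ} (Z : Matrix (Fin N) (Fin k) ℝ) (s : Finset (Fin N)) : Fin k → ℝ :=
  fun j => (s.card : ℝ)⁻¹ * ∑ i ∈ s, Z i j

/-- Intra-class measure `∑_π ∑_{i ∈ π} ‖z_i - μ_π‖²` (Euclidean norm). -/
def intra {N k : ℕ} (cls : Finpartition (Finset.univ : Finset (Fin N)))
    (Z : Matrix (Fin N) (Fin k) ℝ) : ℝ :=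
  ∑ s ∈ cls.parts, ∑ i ∈ s, ‖WithLp.toLp 2 (fun j => Z i j - center Z s j)‖ ^ 2

/-- Inter-class measure `∑_π |π| ‖μ_π - μ_Π‖²` (Euclidean norm). -/
def inter {N k : ℕ} (cls : Finpartition (Finset.univ : Finset (Fin N)))
    (Z : Matrix (Fin N) (Fin k) ℝ) : ℝ :=
  ∑ s ∈ cls.parts, (s.card : ℝ) * ‖WithLp.toLp 2 (fun j => center Z s j - center Z Finset.univ j)‖ ^ 2

/-- The K-means measure. -/
def kms {N k : ℕ} (cls : Finpartition (Finset.univ : Finset (Fin N)))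
    (Z : Matrix (Fin N) (Fin k) ℝ) : ℝ :=
  intra cls Z / inter cls Z

/-- `η₁ = 1 / M_inter(Π, Z)`. -/
def eta1 {N k : ℕ} (cls : Finpartition (Finset.univ : Finset (Fin N)))
    (Z : Matrix (Fin N) (Fin k) ℝ) : ℝ :=
  1 / inter cls Z

/-- `η₂ = M_intra(Π, Z) / M_inter(Π, Z)`. -/
def eta2 {N k : ℕ} (cls : Finpartition (Finset.univ : Finset (Fin N)))
    (Z : Matrix (Fin N) (Fin k) ℝ) : ℝ :=
  intra cls Z / inter cls Z

/-- The class-averaging matrix `H_Π`: its entry at `(x, x')` is `1 / |π|` if `x` and `x'` both lie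
in the class `π`, and `0` if they lie in different classes. -/
def classAvg {N : ℕ} (cls : Finpartition (Finset.univ : Finset (Fin N))) :
    Matrix (Fin N) (Fin N) ℝ :=
  Matrix.of fun x x' => if x' ∈ cls.part x then 1 / ((cls.part x).card : ℝ) else 0

/-- `Υ = (1 + η₂) H_Π - I - (η₂ / N) 𝟏 𝟏ᵀ`. -/
def upsilon {N k : ℕ} (cls : Finpartition (Finset.univ : Finset (Fin N)))
    (Z : Matrix (Fin N) (Fin k) ℝ) : Matrix (Fin N) (Fin N) ℝ :=
  (1 + eta2 cls Z) • classAvg cls - 1 - (eta2 cls Z / (N : ℝ)) • Matrix.of fun _ _ => (1 : ℝ)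

/-- The first-order coefficient
`η₁ Tr(Υ (V_k V_kᵀ 𝔩 𝔩ᵀ (I + V_∅ V_∅ᵀ) - 2 Ã_k diag(𝔩)))`, with `V_∅ = W`. -/
def mainCoeff {N k : ℕ} (hk : k ≤ N) (cls : Finpartition (Finset.univ : Finset (Fin N)))
    (Z : Matrix (Fin N) (Fin k) ℝ) (l : Fin N → ℝ) (V : Matrix (Fin N) (Fin N) ℝ)
    (σ : Fin N → ℝ) (W : Matrix (Fin N) (Fin (N - k)) ℝ) : ℝ :=
  eta1 cls Z * Matrix.trace (upsilon cls Z *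
    (topVec hk V * (topVec hk V)ᵀ * Matrix.vecMulVec l l * (1 + W * Wᵀ)
      - (2 : ℝ) • (rankApprox hk V σ * Matrix.diagonal l)))

end SORL

end

namespace SORL

open scoped Matrix.Norms.L2Operator

/-! ### Operator norms of real matrices -/

/-! The K-means measure sees `Z` only through its Gram matrix: with `H` the class averaging and `J`
the overall averaging, `I - H` and `H - J` are orthogonal projections, and the intra and inter
measures are the traces of `Z Zᵀ` against them (`intra_eq_trace`, `inter_eq_trace`). It therefore
suffices to expand the Gram matrix in `δ`.

At `δ = 0` all degrees are `1`, and the Gram matrix is the truncation `x` of `A(0)` to its top `k`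
eigenvectors. For `δ > 0` it is `s (M - q' M q') s`, with `s = D^{-1/2}`, `M = s A(δ) s` and `q'`
the bottom spectral projection of `M`. Here `s = 1 - (δ/2) diag 𝔩 + O(δ²)`, while Weyl and
Davis–Kahan give `q' - q = O(δ)`, with a constant governed by `a (1 - 1/G₀)`, a lower bound for `λ_k
- λ_{k+1}`. Since `q x = x q = 0`, the term `q' x q'` is `O(δ²)`, so the motion of the projection
does not enter the first-order term `gramDeriv`. The discarded eigenvalues cost at most `2 λ_{k+1} ≤
2 / 𝒢_k`, because a symmetric stochastic matrix has `λ_k ≤ 1`. This is `gram_perturbation`.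

The constants do not depend on `N` because every matrix whose trace is estimated has rank at most a
multiple of `k`, and a trace is at most rank times operator norm (`abs_trace_mul_le`). Expanding the
quotient intra/inter (`abs_quotient_expansion_le`) then produces the linear functional `η₁ Tr(Υ ·)`,
since `Υ = η₂ (H - J) - (I - H)`. -/

theorem abs_dotProduct_mulVec_le {N : ℕ} (A : Matrix (Fin N) (Fin N) ℝ) (x y : Fin N → ℝ) :
    |x ⬝ᵥ A *ᵥ y| ≤ ‖A‖ * (‖WithLp.toLp 2 x‖ * ‖WithLp.toLp 2 y‖) := by
  have h1 := A.l2_opNorm_mulVec (WithLp.toLp 2 y)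
  have h2 := abs_real_inner_le_norm (WithLp.toLp 2 x) (WithLp.toLp 2 (A *ᵥ y))
  have h3 : inner ℝ (WithLp.toLp 2 x) (WithLp.toLp 2 (A *ᵥ y)) = x ⬝ᵥ A *ᵥ y := by
    simp [PiLp.inner_apply, dotProduct, mul_comm]
  rw [h3] at h2
  calc _ ≤ _ := h2
    _ ≤ ‖WithLp.toLp 2 x‖ * (‖A‖ * ‖WithLp.toLp 2 y‖) := by gcongr; exact h1
    _ = _ := by ring

theorem norm_toLp_sq {N : ℕ} (x : Fin N → ℝ) : ‖WithLp.toLp 2 x‖ ^ 2 = x ⬝ᵥ x := by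
  rw [EuclideanSpace.norm_sq_eq]
  simp [dotProduct, sq]

theorem dotProduct_mulVec_self_le {N : ℕ} (A : Matrix (Fin N) (Fin N) ℝ) (x : Fin N → ℝ) :
    x ⬝ᵥ A *ᵥ x ≤ ‖A‖ * (x ⬝ᵥ x) := by
  have := (le_abs_self _).trans (abs_dotProduct_mulVec_le A x x)
  rwa [← sq, norm_toLp_sq] at this

theorem abs_entry_le_norm {N : ℕ} (A : Matrix (Fin N) (Fin N) ℝ) (i j : Fin N) :
    |A i j| ≤ ‖A‖ := by
  have h := abs_dotProduct_mulVec_le A (Pi.single i 1) (Pi.single j 1)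
  simpa using h

theorem norm_transpose_eq {N : ℕ} (A : Matrix (Fin N) (Fin N) ℝ) : ‖Aᵀ‖ = ‖A‖ := by
  rw [← Matrix.conjTranspose_eq_transpose_of_trivial, Matrix.l2_opNorm_conjTranspose]

theorem norm_transpose_mul_self_eq {N : ℕ} (A : Matrix (Fin N) (Fin N) ℝ) :
    ‖Aᵀ * A‖ = ‖A‖ * ‖A‖ := by
  rw [← Matrix.conjTranspose_eq_transpose_of_trivial, Matrix.l2_opNorm_conjTranspose_mul_self]

theorem norm_one_le {N : ℕ} : ‖(1 : Matrix (Fin N) (Fin N) ℝ)‖ ≤ 1 := by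
  rw [← Matrix.diagonal_one, Matrix.l2_opNorm_diagonal]
  exact (pi_norm_le_iff_of_nonneg zero_le_one).2 fun i => by simp

theorem norm_le_one_of_orthogonal {N : ℕ} {U : Matrix (Fin N) (Fin N) ℝ} (hU : Uᵀ * U = 1) :
    ‖U‖ ≤ 1 := by
  have h := norm_transpose_mul_self_eq U
  rw [hU] at h
  nlinarith [norm_one_le (N := N), norm_nonneg U]

theorem norm_le_one_of_projection {N : ℕ} {S : Matrix (Fin N) (Fin N) ℝ} (h1 : Sᵀ = S)
    (h2 : S * S = S) : ‖S‖ ≤ 1 := by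
  have h := norm_transpose_mul_self_eq S
  rw [h1, h2] at h
  nlinarith [norm_nonneg S]

theorem norm_diagonal_le {N : ℕ} {f : Fin N → ℝ} {c : ℝ} (hc : 0 ≤ c) (hf : ∀ i, |f i| ≤ c) :
    ‖Matrix.diagonal f‖ ≤ c := by
  rw [Matrix.l2_opNorm_diagonal]
  exact (pi_norm_le_iff_of_nonneg hc).2 fun i => by simpa using hf i

/-! ### Functions of a matrix given by an orthonormal eigenbasis -/

/-- The matrix with eigenvectors the columns of `V` and eigenvalues `f`. -/
noncomputable def spec {N : ℕ} (V : Matrix (Fin N) (Fin N) ℝ) (f : Fin N → ℝ) :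
    Matrix (Fin N) (Fin N) ℝ := V * Matrix.diagonal f * Vᵀ

section spec

variable {N : ℕ} {V : Matrix (Fin N) (Fin N) ℝ}

theorem spec_mul (hV : Vᵀ * V = 1) (f g : Fin N → ℝ) :
    spec V f * spec V g = spec V fun i => f i * g i := by
  unfold spec
  rw [← Matrix.diagonal_mul_diagonal]
  calc V * Matrix.diagonal f * Vᵀ * (V * Matrix.diagonal g * Vᵀ)
      = V * Matrix.diagonal f * (Vᵀ * V) * Matrix.diagonal g * Vᵀ := by
        simp only [Matrix.mul_assoc]
    _ = _ := by rw [hV, Matrix.mul_one]; simp only [Matrix.mul_assoc]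

theorem spec_add (f g : Fin N → ℝ) : spec V f + spec V g = spec V fun i => f i + g i := by
  unfold spec
  rw [← Matrix.diagonal_add, Matrix.mul_add, Matrix.add_mul]

theorem spec_one (hV : Vᵀ * V = 1) : spec V (fun _ => 1) = 1 := by
  unfold spec
  rw [Matrix.diagonal_one, Matrix.mul_one, mul_eq_one_comm.1 hV]

theorem spec_transpose (f : Fin N → ℝ) : (spec V f)ᵀ = spec V f := by
  simp [spec, Matrix.transpose_mul, Matrix.mul_assoc]

theorem norm_spec_le (hV : Vᵀ * V = 1) {f : Fin N → ℝ} {c : ℝ} (hc : 0 ≤ c)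
    (hf : ∀ i, |f i| ≤ c) : ‖spec V f‖ ≤ c := by
  have h1 := norm_le_one_of_orthogonal hV
  have h2 : ‖Vᵀ‖ ≤ 1 := by rwa [norm_transpose_eq]
  simpa [spec] using norm_mul_le_of_le (norm_mul_le_of_le h1 (norm_diagonal_le hc hf)) h2

theorem dotProduct_spec_mulVec (f x : Fin N → ℝ) :
    x ⬝ᵥ spec V f *ᵥ x = ∑ i, f i * (Vᵀ *ᵥ x) i ^ 2 := by
  unfold spec
  rw [← Matrix.mulVec_mulVec, ← Matrix.mulVec_mulVec, Matrix.dotProduct_mulVec,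
    ← Matrix.mulVec_transpose]
  simp only [dotProduct, Matrix.mulVec_diagonal]
  exact Finset.sum_congr rfl fun i _ => by ring

theorem dotProduct_self_eq_sum (hV : Vᵀ * V = 1) (x : Fin N → ℝ) :
    x ⬝ᵥ x = ∑ i, (Vᵀ *ᵥ x) i ^ 2 := by
  have h := dotProduct_spec_mulVec (V := V) (fun _ => 1) x
  rw [spec_one hV] at h
  simpa using h

/-- **Weyl's inequality** for the ordered eigenvalues. -/
theorem eigenvalue_le_add_norm {V' : Matrix (Fin N) (Fin N) ℝ} (hV : Vᵀ * V = 1)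
    (hV' : V'ᵀ * V' = 1) {f f' : Fin N → ℝ} (hf : Antitone f) (hf' : Antitone f') (i : Fin N) :
    f' i ≤ f i + ‖spec V' f' - spec V f‖ := by
  -- Dimension count: coordinate `i` of `φ c` is always `0`, so `φ` is not surjective, hence not
  -- injective. A nonzero kernel vector `c` gives `V' c` in the span of the columns `j ≤ i` of `V'`
  -- and orthogonal to the columns `j < i` of `V`; the two quadratic forms are compared on it.
  let φ : (Fin N → ℝ) →ₗ[ℝ] (Fin N → ℝ) :=
    { toFun := fun c j => if j < i then (Vᵀ *ᵥ (V' *ᵥ c)) j else if i < j then c j else 0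
      map_add' := fun c d => by
        ext j; simp only [Matrix.mulVec_add, Pi.add_apply]; split_ifs <;> simp
      map_smul' := fun r c => by
        ext j; simp only [Matrix.mulVec_smul, Pi.smul_apply, RingHom.id_apply]
        split_ifs <;> simp }
  have hφ : ¬ Function.Injective φ := fun h => by
    obtain ⟨c, hc⟩ := LinearMap.injective_iff_surjective.1 h (fun _ => 1)
    have := congrFun hc i
    simp [φ] at this
  obtain ⟨c, hc, hc0⟩ : ∃ c, φ c = 0 ∧ c ≠ 0 := by
    rw [← LinearMap.ker_eq_bot, LinearMap.ker_eq_bot'] at hφ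
    push Not at hφ
    exact hφ
  have hlow : ∀ j, j < i → (Vᵀ *ᵥ (V' *ᵥ c)) j = 0 := fun j hj => by
    simpa [φ, hj] using congrFun hc j
  have hhigh : ∀ j, i < j → c j = 0 := fun j hj => by
    simpa [φ, hj, hj.not_gt] using congrFun hc j
  set x := V' *ᵥ c with hx
  have hxc : V'ᵀ *ᵥ x = c := by rw [hx, Matrix.mulVec_mulVec, hV', Matrix.one_mulVec]
  have hpos : 0 < x ⬝ᵥ x := by
    rw [dotProduct_self_eq_sum hV', hxc]
    obtain ⟨j, hj⟩ := Function.ne_iff.1 hc0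
    exact Finset.sum_pos' (fun _ _ => sq_nonneg _) ⟨j, Finset.mem_univ _, sq_pos_of_ne_zero hj⟩
  have h1 : f' i * (x ⬝ᵥ x) ≤ x ⬝ᵥ spec V' f' *ᵥ x := by
    rw [dotProduct_spec_mulVec, dotProduct_self_eq_sum hV', hxc, Finset.mul_sum]
    refine Finset.sum_le_sum fun j _ => ?_
    rcases le_or_gt j i with hj | hj
    · exact mul_le_mul_of_nonneg_right (hf' hj) (sq_nonneg _)
    · simp [hhigh j hj]
  have h2 : x ⬝ᵥ spec V f *ᵥ x ≤ f i * (x ⬝ᵥ x) := by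
    rw [dotProduct_spec_mulVec, dotProduct_self_eq_sum hV, Finset.mul_sum]
    refine Finset.sum_le_sum fun j _ => ?_
    rcases lt_or_ge j i with hj | hj
    · simp [hlow j hj]
    · exact mul_le_mul_of_nonneg_right (hf hj) (sq_nonneg _)
  have h3 := dotProduct_mulVec_self_le (spec V' f' - spec V f) x
  rw [Matrix.sub_mulVec, dotProduct_sub] at h3
  refine le_of_mul_le_mul_right ?_ hpos
  linarith

/-- The orthogonal projection onto the span of the first `k` columns of `V`. -/
noncomputable def topProj (k : ℕ) (V : Matrix (Fin N) (Fin N) ℝ) : Matrix (Fin N) (Fin N) ℝ :=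
  spec V fun i => if (i : ℕ) < k then 1 else 0

/-- The orthogonal projection onto the span of the remaining columns of `V`. -/
noncomputable def botProj (k : ℕ) (V : Matrix (Fin N) (Fin N) ℝ) : Matrix (Fin N) (Fin N) ℝ :=
  spec V fun i => if (i : ℕ) < k then 0 else 1

theorem topProj_add_botProj (hV : Vᵀ * V = 1) (k : ℕ) : topProj k V + botProj k V = 1 := by
  rw [topProj, botProj, spec_add, ← spec_one hV]
  congr 1; ext i; split_ifs <;> simp

theorem norm_topProj_le (hV : Vᵀ * V = 1) (k : ℕ) : ‖topProj k V‖ ≤ 1 :=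
  norm_spec_le hV zero_le_one fun i => by split_ifs <;> simp

theorem norm_botProj_le (hV : Vᵀ * V = 1) (k : ℕ) : ‖botProj k V‖ ≤ 1 :=
  norm_spec_le hV zero_le_one fun i => by split_ifs <;> simp

/-- **Davis–Kahan**: the bottom spectral projection of one matrix almost annihilates the top
spectral projection of a nearby one. -/
theorem norm_botProj_mul_topProj_le {V' : Matrix (Fin N) (Fin N) ℝ} (hV : Vᵀ * V = 1)
    (hV' : V'ᵀ * V' = 1) {f f' : Fin N → ℝ} (hf'0 : ∀ i, 0 ≤ f' i) {k : ℕ} {a b : ℝ} (ha : 0 < a)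
    (hb : 0 ≤ b) (hfa : ∀ i : Fin N, (i : ℕ) < k → a ≤ f i)
    (hfb : ∀ i : Fin N, k ≤ (i : ℕ) → f' i ≤ b) :
    (a - b) * ‖botProj k V' * topProj k V‖ ≤ ‖spec V' f' - spec V f‖ := by
  set X := botProj k V' * topProj k V with hX
  set E := spec V' f' - spec V f with hE
  -- The first matrix is invertible on its top eigenspace with inverse of norm at most `1/a`, so `a
  -- ‖X‖ ≤ ‖X * spec V f‖`.
  have hinv : X = X * spec V f * spec V (fun i => if (i : ℕ) < k then (f i)⁻¹ else 0) := by
    rw [hX, Matrix.mul_assoc, Matrix.mul_assoc, spec_mul hV, topProj, spec_mul hV]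
    congr 2; ext i; split_ifs with h
    · rw [one_mul, mul_inv_cancel₀ (ha.trans_le (hfa i h)).ne']
    · simp
  have h1 : ‖X‖ ≤ ‖X * spec V f‖ * a⁻¹ := by
    conv_lhs => rw [hinv]
    refine norm_mul_le_of_le le_rfl (norm_spec_le hV (by positivity) fun i => ?_)
    split_ifs with h
    · rw [abs_of_nonneg (inv_nonneg.2 (ha.le.trans (hfa i h)))]
      exact inv_anti₀ ha (hfa i h)
    · simp [ha.le]
  have htop : topProj k V * spec V f = spec V f * topProj k V := by
    rw [topProj, spec_mul hV, spec_mul hV]; congr 1; ext i; ring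
  have hbot : botProj k V' * spec V' f' =
      spec V' (fun i => if (i : ℕ) < k then 0 else f' i) * botProj k V' := by
    rw [botProj, spec_mul hV', spec_mul hV']; congr 1; ext i; split_ifs <;> simp
  -- Sylvester equation for `X`: the perturbed matrix acts on the left only through its bottom
  -- eigenvalues, which are at most `b`. Hence `a ‖X‖ ≤ b ‖X‖ + ‖E‖`.
  have h2 : X * spec V f = spec V' (fun i => if (i : ℕ) < k then 0 else f' i) * X
      - botProj k V' * E * topProj k V := by
    rw [hE, hX, Matrix.mul_sub, Matrix.sub_mul, hbot, Matrix.mul_assoc, htop]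
    simp only [Matrix.mul_assoc]; abel
  have h3 : ‖X * spec V f‖ ≤ b * ‖X‖ + ‖E‖ := by
    rw [h2]
    refine (norm_sub_le _ _).trans (add_le_add ?_ ?_)
    · refine norm_mul_le_of_le (norm_spec_le hV' hb fun i => ?_) le_rfl
      split_ifs with h
      · simpa using hb
      · rw [abs_of_nonneg (hf'0 i)]; exact hfb i (not_lt.1 h)
    · simpa using norm_mul_le_of_le (norm_mul_le_of_le (norm_botProj_le hV' k) (le_refl ‖E‖))
        (norm_topProj_le hV k)
  have h4 : ‖X‖ * a ≤ ‖X * spec V f‖ := by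
    have := mul_le_mul_of_nonneg_right h1 ha.le
    rwa [mul_assoc, inv_mul_cancel₀ ha.ne', mul_one] at this
  linarith

end spec

/-! ### Traces of matrices of small rank -/

theorem rank_add_le {N : ℕ} (A B : Matrix (Fin N) (Fin N) ℝ) :
    (A + B).rank ≤ A.rank + B.rank := by
  unfold Matrix.rank
  rw [Matrix.mulVecLin_add]
  exact (Submodule.finrank_mono (LinearMap.range_add_le _ _)).trans
    (Submodule.finrank_add_le_finrank_add_finrank _ _)

theorem rank_neg_eq {N : ℕ} (A : Matrix (Fin N) (Fin N) ℝ) : (-A).rank = A.rank := by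
  have h : ∀ B : Matrix (Fin N) (Fin N) ℝ, (-B).rank ≤ B.rank := fun B => by
    have := Matrix.rank_mul_le_left B (-1 : Matrix (Fin N) (Fin N) ℝ)
    rwa [Matrix.mul_neg, Matrix.mul_one] at this
  refine le_antisymm (h A) ?_
  conv_lhs => rw [← neg_neg A]
  exact h (-A)

theorem rank_sub_le {N : ℕ} (A B : Matrix (Fin N) (Fin N) ℝ) :
    (A - B).rank ≤ A.rank + B.rank := by
  rw [sub_eq_add_neg, ← rank_neg_eq B]; exact rank_add_le A (-B)

/-- In an eigenbasis of `Y` the trace is a sum with at most `r` nonzero terms, each an eigenvalue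
bounded by `e` times a diagonal entry of a contraction. This replaces the dimension `N` by the rank.
-/
theorem abs_trace_mul_le {N : ℕ} {S Y : Matrix (Fin N) (Fin N) ℝ} (hS : ‖S‖ ≤ 1) (hY : Yᵀ = Y)
    {r : ℕ} (hr : Y.rank ≤ r) {e : ℝ} (he : ‖Y‖ ≤ e) : |(S * Y).trace| ≤ r * e := by
  have hH : Y.IsHermitian := by
    rw [Matrix.IsHermitian, Matrix.conjTranspose_eq_transpose_of_trivial, hY]
  set U : Matrix (Fin N) (Fin N) ℝ := (hH.eigenvectorUnitary).1 with hU
  set y := hH.eigenvalues with hy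
  have hUU : Uᵀ * U = 1 := by
    rw [← Matrix.conjTranspose_eq_transpose_of_trivial, ← Matrix.star_eq_conjTranspose]
    exact Unitary.coe_star_mul_self hH.eigenvectorUnitary
  have hYU : Y = U * Matrix.diagonal y * Uᵀ := by
    have := hH.spectral_theorem
    rw [Unitary.conjStarAlgAut_apply, Matrix.star_eq_conjTranspose,
      Matrix.conjTranspose_eq_transpose_of_trivial] at this
    exact this
  have hUn := norm_le_one_of_orthogonal hUU
  have hUtn : ‖Uᵀ‖ ≤ 1 := by rwa [norm_transpose_eq]
  have he0 : 0 ≤ e := (norm_nonneg _).trans he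
  have hyle : ∀ i, |y i| ≤ e := fun i => by
    have h1 : Uᵀ * Y * U = Matrix.diagonal y := by
      rw [hYU]
      calc _ = (Uᵀ * U) * Matrix.diagonal y * (Uᵀ * U) := by simp only [Matrix.mul_assoc]
        _ = _ := by rw [hUU]; simp
    have h2 := abs_entry_le_norm (Uᵀ * Y * U) i i
    have h3 := norm_mul_le_of_le (norm_mul_le_of_le hUtn he) hUn
    rw [h1, Matrix.diagonal_apply_eq, ← h1] at h2
    linarith
  have htr : (S * Y).trace = ∑ i, (Uᵀ * S * U) i i * y i := by
    calc (S * Y).trace = ((S * U * Matrix.diagonal y) * Uᵀ).trace := by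
          conv_lhs => rw [hYU]
          simp only [Matrix.mul_assoc]
      _ = (Uᵀ * S * U * Matrix.diagonal y).trace := by
          rw [Matrix.trace_mul_comm]; simp only [Matrix.mul_assoc]
      _ = _ := by simp [Matrix.trace, Matrix.mul_diagonal]
  have hent : ∀ i, |(Uᵀ * S * U) i i| ≤ 1 := fun i => by
    have h3 := norm_mul_le_of_le (norm_mul_le_of_le hUtn hS) hUn
    have := abs_entry_le_norm (Uᵀ * S * U) i i
    linarith
  have hcard : (Finset.univ.filter fun i => y i ≠ 0).card ≤ r := by
    rw [hH.rank_eq_card_non_zero_eigs, Fintype.card_subtype] at hr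
    exact hr
  calc |(S * Y).trace| ≤ ∑ i, |(Uᵀ * S * U) i i * y i| := by
        rw [htr]; exact Finset.abs_sum_le_sum_abs _ _
    _ ≤ ∑ i, if y i ≠ 0 then e else 0 := by
        refine Finset.sum_le_sum fun i _ => ?_
        split_ifs with h
        · rw [abs_mul]
          simpa using mul_le_mul (hent i) (hyle i) (abs_nonneg _) zero_le_one
        · rw [not_not.1 h]; simp
    _ = ((Finset.univ.filter fun i => y i ≠ 0).card : ℝ) * e := by
        rw [← Finset.sum_filter, Finset.sum_const, nsmul_eq_mul]
    _ ≤ r * e := by gcongr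

end SORL

namespace SORL

/-! ### Perturbation estimates in a normed ring -/

section NormedRing

variable {R : Type*} [NormedRing R]

theorem norm_sandwich_le {s x : R} {r : ℝ} (hs : ‖s‖ ≤ 1) (hx : ‖x‖ ≤ r) : ‖s * x * s‖ ≤ r := by
  simpa using norm_mul_le_of_le (norm_mul_le_of_le hs hx) hs

theorem norm_sandwich_sub_le {s s' x : R} {δ r : ℝ} (hs : ‖s‖ ≤ 1) (hs' : ‖s'‖ ≤ 1)
    (hd : ‖s - s'‖ ≤ δ) (hx : ‖x‖ ≤ r) : ‖s * x * s - s' * x * s'‖ ≤ 2 * δ * r := by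
  have h : s * x * s - s' * x * s' = (s - s') * x * s + s' * x * (s - s') := by noncomm_ring
  rw [h]
  refine (norm_add_le_of_le (norm_mul_le_of_le (norm_mul_le_of_le hd hx) hs)
    (norm_mul_le_of_le (norm_mul_le_of_le hs' hx) hd)).trans_eq ?_
  ring

theorem norm_sandwich_sub_self_le {s x : R} {δ r : ℝ} (hs : ‖s‖ ≤ 1) (h1 : ‖(1 : R)‖ ≤ 1)
    (hd : ‖s - 1‖ ≤ δ) (hx : ‖x‖ ≤ r) : ‖s * x * s - x‖ ≤ 2 * δ * r := by
  simpa using norm_sandwich_sub_le hs h1 hd hx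

/-- Here `s = 1 - l + O(δ²)`; the identity in the proof isolates the quadratic term and the two
Taylor remainders. -/
theorem norm_sandwich_second_order_le {s l x : R} {δ : ℝ} (hd : ‖s - 1‖ ≤ δ)
    (ht : ‖s - 1 + l‖ ≤ δ ^ 2) (hx : ‖x‖ ≤ 1) :
    ‖s * x * s - x + (l * x + x * l)‖ ≤ 3 * δ ^ 2 := by
  have h : s * x * s - x + (l * x + x * l)
      = (s - 1) * x * (s - 1) + (s - 1 + l) * x + x * (s - 1 + l) := by noncomm_ring
  rw [h]
  refine (norm_add_le_of_le (norm_add_le_of_le (norm_mul_le_of_le (norm_mul_le_of_le hd hx) hd)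
    (norm_mul_le_of_le ht hx)) (norm_mul_le_of_le hx ht)).trans_eq ?_
  ring

/-- In the application `s = D^{-1/2}`, `x` and `r` are the top and bottom parts of `A(0)`, `b = δ 𝔩
𝔩ᵀ`, and `q`, `q'` are the bottom projections before and after perturbation. The bound does not
involve the size of `r`: it must keep the inter-class measure positive even when `1 / 𝒢_k` is not
small. -/
theorem norm_rescaled_truncation_sub_le {s x r b q q' : R} {δ c : ℝ} (h1 : ‖(1 : R)‖ ≤ 1)
    (hs : ‖s‖ ≤ 1) (hd : ‖s - 1‖ ≤ δ) (hx : ‖x‖ ≤ 1) (hxr : ‖x + r‖ ≤ 1)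
    (hb : ‖b‖ ≤ δ) (hq : ‖q‖ ≤ 1) (hq' : ‖q'‖ ≤ 1) (hqq : ‖q' - q‖ ≤ 2 * c * δ)
    (hx' : x = (x + r) - q * (x + r) * q) :
    ‖s * (s * (x + r + b) * s - q' * (s * (x + r + b) * s) * q') * s - x‖ ≤ (8 + 4 * c) * δ := by
  set m := s * (x + r + b) * s with hm
  have hm1 : ‖m - (x + r)‖ ≤ 3 * δ := by
    have h : m - (x + r) = (s * (x + r) * s - (x + r)) + s * b * s := by rw [hm]; noncomm_ring
    rw [h]
    refine (norm_add_le_of_le (norm_sandwich_sub_self_le hs h1 hd hxr)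
      (norm_sandwich_le hs hb)).trans_eq (by ring)
  have hg : ‖(m - q' * m * q') - x‖ ≤ (6 + 4 * c) * δ := by
    have h : (m - q' * m * q') - x = (m - (x + r)) - q' * (m - (x + r)) * q'
        - (q' * (x + r) * q' - q * (x + r) * q) := by
      conv_lhs => rw [hx']
      noncomm_ring
    rw [h]
    refine (norm_sub_le_of_le (norm_sub_le_of_le hm1 (norm_sandwich_le hq' hm1))
      (norm_sandwich_sub_le hq' hq hqq hxr)).trans_eq (by ring)
  have h : s * (m - q' * m * q') * s - x
      = s * ((m - q' * m * q') - x) * s + (s * x * s - x) := by noncomm_ring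
  rw [h]
  refine (norm_add_le_of_le (norm_sandwich_le hs hg)
    (norm_sandwich_sub_self_le hs h1 hd hx)).trans_eq (by ring)

/-- Same roles, with `l` the linear part of `1 - s`. The factor `2` in front of `l * x + x * l`
arises because `s` acts twice, in normalizing the adjacency matrix and in defining `Z`. -/
theorem norm_rescaled_truncation_second_order_le {s l x r b q q' : R} {δ c ε : ℝ}
    (h1 : ‖(1 : R)‖ ≤ 1) (hs : ‖s‖ ≤ 1) (hd : ‖s - 1‖ ≤ δ)
    (ht : ‖s - 1 + l‖ ≤ δ ^ 2) (hl : ‖l‖ ≤ δ / 2) (hx : ‖x‖ ≤ 1) (hr : ‖r‖ ≤ ε)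
    (hb : ‖b‖ ≤ δ) (hq : ‖q‖ ≤ 1) (hq' : ‖q'‖ ≤ 1) (hqq : ‖q' - q‖ ≤ 2 * c * δ)
    (hqx : q * x = 0) (hxq : x * q = 0) (hqxq : ‖q' * x * q'‖ ≤ (c * δ) ^ 2) :
    ‖s * (s * (x + r + b) * s - q' * (s * (x + r + b) * s) * q') * s - x
        - (b - q * b * q - 2 * (l * x + x * l))‖
      ≤ 2 * ε + (21 + 8 * c + c ^ 2) * δ ^ 2 := by
  set m := s * (x + r + b) * s with hm
  set f := b - (l * x + x * l) with hf
  have hfn : ‖f‖ ≤ 2 * δ := by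
    refine (norm_sub_le_of_le hb (norm_add_le_of_le (norm_mul_le_of_le hl hx)
      (norm_mul_le_of_le hx hl))).trans_eq (by ring)
  have hm1 : ‖m - x - f‖ ≤ ε + 5 * δ ^ 2 := by
    have h : m - x - f = s * r * s + (s * x * s - x + (l * x + x * l)) + (s * b * s - b) := by
      rw [hm, hf]; noncomm_ring
    rw [h]
    refine (norm_add_le_of_le (norm_add_le_of_le (norm_sandwich_le hs hr)
      (norm_sandwich_second_order_le hd ht hx))
      (norm_sandwich_sub_self_le hs h1 hd hb)).trans_eq (by ring)
  have hg : ‖(m - q' * m * q') - (x + f - q * f * q)‖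
      ≤ 2 * (ε + 5 * δ ^ 2) + (c * δ) ^ 2 + 8 * c * δ ^ 2 := by
    have h : (m - q' * m * q') - (x + f - q * f * q) = (m - x - f) - q' * (m - x - f) * q'
        - q' * x * q' - (q' * f * q' - q * f * q) := by noncomm_ring
    rw [h]
    refine (norm_sub_le_of_le (norm_sub_le_of_le (norm_sub_le_of_le hm1
      (norm_sandwich_le hq' hm1)) hqxq) (norm_sandwich_sub_le hq' hq hqq hfn)).trans_eq (by ring)
  -- The rescaling part of `f` has a factor `x` next to one of the `q`, so only `b` survives the
  -- compression.
  have hqf : q * f * q = q * b * q := by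
    have h : q * f * q = q * b * q - (q * l * (x * q) + (q * x) * l * q) := by
      rw [hf]; noncomm_ring
    rw [h, hqx, hxq]; simp
  have hfq : ‖f - q * f * q‖ ≤ 4 * δ :=
    (norm_sub_le_of_le hfn (norm_sandwich_le hq hfn)).trans_eq (by ring)
  have h : s * (m - q' * m * q') * s - x - (b - q * b * q - 2 * (l * x + x * l))
      = s * ((m - q' * m * q') - (x + f - q * f * q)) * s
        + (s * (f - q * f * q) * s - (f - q * f * q))
        + (s * x * s - x + (l * x + x * l)) := by
    have h' : b - q * b * q - 2 * (l * x + x * l) = f - q * f * q - (l * x + x * l) := by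
      rw [hqf, hf]; noncomm_ring
    rw [h']; noncomm_ring
  rw [h]
  refine (norm_add_le_of_le (norm_add_le_of_le (norm_sandwich_le hs hg)
    (norm_sandwich_sub_self_le hs h1 hd hfq))
    (norm_sandwich_second_order_le hd ht hx)).trans_eq (by ring)

end NormedRing

theorem abs_inv_sqrt_bounds {t : ℝ} (ht : 0 ≤ t) :
    |(Real.sqrt (1 + t))⁻¹| ≤ 1 ∧ |(Real.sqrt (1 + t))⁻¹ - 1| ≤ t ∧
      |(Real.sqrt (1 + t))⁻¹ - 1 + t / 2| ≤ t ^ 2 := by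
  set u := Real.sqrt (1 + t) with hu
  have hu1 : 1 ≤ u := Real.one_le_sqrt.2 (by linarith)
  have hut : t = u ^ 2 - 1 := by rw [hu, Real.sq_sqrt (by linarith)]; ring
  have hu0 : 0 < u := by linarith
  have hi : u⁻¹ ≤ 1 := inv_le_one_of_one_le₀ hu1
  have hi0 : 0 < u⁻¹ := inv_pos.2 hu0
  have hui : u * u⁻¹ = 1 := mul_inv_cancel₀ hu0.ne'
  refine ⟨by rw [abs_of_pos hi0]; exact hi, ?_, ?_⟩
  · rw [abs_sub_comm, abs_of_nonneg (by linarith)]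
    nlinarith
  · have h : u⁻¹ - 1 + t / 2 = (u - 1) ^ 2 * ((1 + 2 * u⁻¹) / 2) := by
      rw [hut]; field_simp; ring
    rw [h, abs_of_nonneg (by positivity), hut]
    have : (u ^ 2 - 1) ^ 2 = (u - 1) ^ 2 * (u + 1) ^ 2 := by ring
    rw [this]
    refine mul_le_mul_of_nonneg_left ?_ (sq_nonneg _)
    nlinarith

end SORL

namespace SORL

/-! ### Spectral representation and its Gram matrix -/

theorem sum_castLE_eq {N k : ℕ} (hk : k ≤ N) (f : Fin N → ℝ) :
    ∑ j, f (Fin.castLE hk j) = ∑ i : Fin N, if (i : ℕ) < k then f i else 0 := by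
  obtain ⟨m, rfl⟩ := Nat.exists_eq_add_of_le hk
  rw [Fin.sum_univ_add]
  simp
  rfl

theorem topVec_mul_diagonal_mul_transpose {N k : ℕ} (hk : k ≤ N) (V : Matrix (Fin N) (Fin N) ℝ)
    (g : Fin N → ℝ) :
    topVec hk V * Matrix.diagonal (fun j => g (Fin.castLE hk j)) * (topVec hk V)ᵀ
      = spec V fun i => if (i : ℕ) < k then g i else 0 := by
  ext x y
  simp only [spec, Matrix.mul_apply (M := _ * Matrix.diagonal _), Matrix.mul_diagonal,
    Matrix.transpose_apply, topVec, Matrix.submatrix_apply, id]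
  rw [sum_castLE_eq hk fun i => V x i * g i * V y i]
  exact Finset.sum_congr rfl fun i _ => by split_ifs <;> simp

theorem topVec_mul_transpose {N k : ℕ} (hk : k ≤ N) (V : Matrix (Fin N) (Fin N) ℝ) :
    topVec hk V * (topVec hk V)ᵀ = topProj k V := by
  have := topVec_mul_diagonal_mul_transpose hk V fun _ => 1
  rwa [Matrix.diagonal_one, Matrix.mul_one] at this

theorem transpose_topVec_mul {N k : ℕ} (hk : k ≤ N) {V : Matrix (Fin N) (Fin N) ℝ}
    (hV : Vᵀ * V = 1) : (topVec hk V)ᵀ * topVec hk V = 1 := by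
  have : (topVec hk V)ᵀ * topVec hk V = (Vᵀ * V).submatrix (Fin.castLE hk) (Fin.castLE hk) := by
    ext i j; simp [topVec, Matrix.mul_apply]
  rw [this, hV]
  exact Matrix.submatrix_one _ (Fin.castLE_injective hk)

theorem rankApprox_eq_spec {N k : ℕ} (hk : k ≤ N) (V : Matrix (Fin N) (Fin N) ℝ)
    (σ : Fin N → ℝ) : rankApprox hk V σ = spec V fun i => if (i : ℕ) < k then σ i else 0 :=
  topVec_mul_diagonal_mul_transpose hk V σ

theorem rep_mul_transpose {N k : ℕ} (hk : k ≤ N) (A V : Matrix (Fin N) (Fin N) ℝ)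
    {σ : Fin N → ℝ} (hσ : ∀ j, 0 ≤ σ j) :
    rep hk A V σ * (rep hk A V σ)ᵀ
      = invSqrtDeg A * (spec V fun i => if (i : ℕ) < k then σ i else 0) * invSqrtDeg A := by
  have hd : Matrix.diagonal (topVal hk σ) = (Matrix.diagonal fun j => √(topVal hk σ j))
      * (Matrix.diagonal fun j => √(topVal hk σ j)) := by
    rw [Matrix.diagonal_mul_diagonal]
    congr 1; ext j; exact (Real.mul_self_sqrt (hσ _)).symm
  rw [← rankApprox_eq_spec hk, rankApprox, hd, rep]
  simp only [Matrix.transpose_mul, Matrix.diagonal_transpose, invSqrtDeg, Matrix.mul_assoc]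

theorem rank_mul_transpose_le {N k : ℕ} (Z : Matrix (Fin N) (Fin k) ℝ) : (Z * Zᵀ).rank ≤ k := by
  refine (Matrix.rank_mul_le_left _ _).trans ?_
  simpa using Matrix.rank_le_card_width Z

theorem rank_topProj_le {N k : ℕ} (hk : k ≤ N) (V : Matrix (Fin N) (Fin N) ℝ) :
    (topProj k V).rank ≤ k := by
  rw [← topVec_mul_transpose hk]; exact rank_mul_transpose_le _

/-- `[V_k, W]` is square with orthonormal columns, hence has orthonormal rows, so `V_k V_kᵀ + W Wᵀ =
1` whichever null basis is chosen. -/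
theorem mul_transpose_eq_botProj {N k : ℕ} (hk : k ≤ N) {V : Matrix (Fin N) (Fin N) ℝ}
    (hV : Vᵀ * V = 1) {W : Matrix (Fin N) (Fin (N - k)) ℝ} (hW : IsNullBasis (topVec hk V) W) :
    W * Wᵀ = botProj k V := by
  have e : Fin N ≃ Fin k ⊕ Fin (N - k) :=
    (finCongr (Nat.add_sub_of_le hk).symm).trans finSumFinEquiv.symm
  have h0 : Wᵀ * topVec hk V = 0 := by
    have := congrArg Matrix.transpose hW.2
    simpa [Matrix.transpose_mul] using this
  have h : Matrix.fromCols (topVec hk V) W * Matrix.fromRows (topVec hk V)ᵀ Wᵀ = 1 := by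
    rw [Matrix.fromCols_mul_fromRows_eq_one_comm e, Matrix.fromRows_mul_fromCols, transpose_topVec_mul hk hV, hW.1, hW.2, h0]
    exact Matrix.fromBlocks_one
  rw [Matrix.fromCols_mul_fromRows, topVec_mul_transpose, ← topProj_add_botProj hV k] at h
  exact add_left_cancel h

/-! ### The K-means measure as traces against projections -/

theorem sum_parts_eq {N : ℕ} (cls : Finpartition (Finset.univ : Finset (Fin N)))
    (F : Finset (Fin N) → Fin N → ℝ) :
    ∑ s ∈ cls.parts, ∑ i ∈ s, F s i = ∑ i, F (cls.part i) i := by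
  have h : ∑ i, F (cls.part i) i = ∑ i ∈ cls.parts.biUnion id, F (cls.part i) i := by
    rw [cls.biUnion_parts]
  rw [h, Finset.sum_biUnion cls.disjoint]
  refine Finset.sum_congr rfl fun s hs => Finset.sum_congr rfl fun i hi => ?_
  rw [cls.part_eq_of_mem hs hi]

/-- The matrix averaging over all indices. -/
noncomputable def meanAvg (N : ℕ) : Matrix (Fin N) (Fin N) ℝ := Matrix.of fun _ _ => (N : ℝ)⁻¹

theorem meanAvg_transpose (N : ℕ) : (meanAvg N)ᵀ = meanAvg N := rfl

theorem meanAvg_mul_self (N : ℕ) : meanAvg N * meanAvg N = meanAvg N := by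
  ext x y
  have : (N : ℝ) ≠ 0 := by exact_mod_cast x.pos.ne'
  simp [meanAvg, Matrix.mul_apply, this]

section classAvg

variable {N k : ℕ} (cls : Finpartition (Finset.univ : Finset (Fin N)))

theorem card_part_pos (x : Fin N) : 0 < ((cls.part x).card : ℝ) := by
  exact_mod_cast (cls.part_nonempty.2 (Finset.mem_univ x)).card_pos

theorem mem_part_comm {x y : Fin N} : y ∈ cls.part x ↔ x ∈ cls.part y := by
  rw [cls.mem_part_iff_part_eq_part (Finset.mem_univ _) (Finset.mem_univ _),
    cls.mem_part_iff_part_eq_part (Finset.mem_univ _) (Finset.mem_univ _), eq_comm]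

theorem part_eq_of_mem_part {x y : Fin N} (h : y ∈ cls.part x) : cls.part y = cls.part x :=
  (cls.mem_part_iff_part_eq_part (Finset.mem_univ _) (Finset.mem_univ _)).1 h

theorem classAvg_mul_apply {m : Type*} (M : Matrix (Fin N) m ℝ) (x : Fin N) (j : m) :
    (classAvg cls * M) x j = ((cls.part x).card : ℝ)⁻¹ * ∑ i ∈ cls.part x, M i j := by
  simp [Matrix.mul_apply, classAvg, ite_mul, Finset.mul_sum, Finset.sum_ite_mem]

theorem classAvg_transpose : (classAvg cls)ᵀ = classAvg cls := by
  ext x y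
  simp only [Matrix.transpose_apply, classAvg, Matrix.of_apply]
  by_cases h : y ∈ cls.part x
  · rw [if_pos h, if_pos ((mem_part_comm cls).1 h), part_eq_of_mem_part cls h]
  · rw [if_neg h, if_neg fun h' => h ((mem_part_comm cls).1 h')]

theorem classAvg_mul_of_forall {m : Type*} (M : Matrix (Fin N) m ℝ)
    (hM : ∀ x, ∀ y ∈ cls.part x, ∀ j, M y j = M x j) : classAvg cls * M = M := by
  ext x j
  rw [classAvg_mul_apply, Finset.sum_congr rfl fun y hy => hM x y hy j, Finset.sum_const,
    nsmul_eq_mul, inv_mul_cancel_left₀ (card_part_pos cls x).ne']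

theorem classAvg_mul_self : classAvg cls * classAvg cls = classAvg cls :=
  classAvg_mul_of_forall cls _ fun x y hy j => by
    simp only [classAvg, Matrix.of_apply, part_eq_of_mem_part cls hy]

theorem classAvg_mul_meanAvg : classAvg cls * meanAvg N = meanAvg N :=
  classAvg_mul_of_forall cls _ fun _ _ _ _ => rfl

theorem meanAvg_mul_classAvg : meanAvg N * classAvg cls = meanAvg N := by
  have := congrArg Matrix.transpose (classAvg_mul_meanAvg cls)
  rwa [Matrix.transpose_mul, classAvg_transpose, meanAvg_transpose] at this

/-- The projection onto the within-class variation. -/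
noncomputable def withinProj : Matrix (Fin N) (Fin N) ℝ := 1 - classAvg cls

/-- The projection onto the between-class variation. -/
noncomputable def betweenProj : Matrix (Fin N) (Fin N) ℝ := classAvg cls - meanAvg N

theorem withinProj_transpose : (withinProj cls)ᵀ = withinProj cls := by
  simp [withinProj, classAvg_transpose]

theorem betweenProj_transpose : (betweenProj cls)ᵀ = betweenProj cls := by
  simp [betweenProj, classAvg_transpose, meanAvg_transpose]

theorem withinProj_mul_self : withinProj cls * withinProj cls = withinProj cls := by
  simp only [withinProj, Matrix.sub_mul, Matrix.mul_sub, classAvg_mul_self, Matrix.one_mul,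
    Matrix.mul_one]
  abel

theorem betweenProj_mul_self : betweenProj cls * betweenProj cls = betweenProj cls := by
  simp only [betweenProj, Matrix.sub_mul, Matrix.mul_sub, classAvg_mul_self,
    classAvg_mul_meanAvg, meanAvg_mul_classAvg, meanAvg_mul_self]
  abel

/-- The left side is `Tr(S Z Zᵀ Sᵀ)`; cyclicity and `Sᵀ S = S` remove one factor. -/
theorem sum_norm_sq_rows_eq_trace {S : Matrix (Fin N) (Fin N) ℝ} (h1 : Sᵀ = S) (h2 : S * S = S)
    (Z : Matrix (Fin N) (Fin k) ℝ) :
    ∑ i, ‖WithLp.toLp 2 fun j => (S * Z) i j‖ ^ 2 = (S * (Z * Zᵀ)).trace := by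
  have h : (S * (Z * Zᵀ)).trace = ((S * Z) * (S * Z)ᵀ).trace := by
    rw [Matrix.transpose_mul, h1, ← Matrix.mul_assoc (S * Z), Matrix.trace_mul_comm _ S]
    simp only [← Matrix.mul_assoc, h2]
  rw [h]
  simp only [EuclideanSpace.norm_sq_eq, Real.norm_eq_abs, sq_abs]
  simp only [Matrix.trace, Matrix.diag_apply, Matrix.mul_apply (M := S * Z),
    Matrix.transpose_apply, sq]

theorem intra_eq_trace (Z : Matrix (Fin N) (Fin k) ℝ) :
    intra cls Z = (withinProj cls * (Z * Zᵀ)).trace := by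
  rw [← sum_norm_sq_rows_eq_trace (withinProj_transpose cls) (withinProj_mul_self cls), intra,
    sum_parts_eq cls fun s i => ‖WithLp.toLp 2 fun j => Z i j - center Z s j‖ ^ 2]
  refine Finset.sum_congr rfl fun i _ => ?_
  congr 3; ext j
  rw [withinProj, Matrix.sub_mul, Matrix.one_mul, Matrix.sub_apply, classAvg_mul_apply, center]

theorem inter_eq_trace (Z : Matrix (Fin N) (Fin k) ℝ) :
    inter cls Z = (betweenProj cls * (Z * Zᵀ)).trace := by
  have h : inter cls Z = ∑ s ∈ cls.parts, ∑ _i ∈ s,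
      ‖WithLp.toLp 2 fun j => center Z s j - center Z Finset.univ j‖ ^ 2 := by
    simp [inter]
  rw [h, ← sum_norm_sq_rows_eq_trace (betweenProj_transpose cls) (betweenProj_mul_self cls),
    sum_parts_eq cls fun s _ => ‖WithLp.toLp 2 fun j => center Z s j - center Z Finset.univ j‖ ^ 2]
  refine Finset.sum_congr rfl fun i _ => ?_
  congr 3; ext j
  rw [betweenProj, Matrix.sub_mul, Matrix.sub_apply, classAvg_mul_apply, center, center,
    Matrix.mul_apply]
  simp [meanAvg, Finset.mul_sum]

/-- In this form `Υ` is, up to the factor `η₁`, minus the differential of intra/inter with respect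
to the Gram matrix. -/
theorem upsilon_eq (Z : Matrix (Fin N) (Fin k) ℝ) :
    upsilon cls Z = eta2 cls Z • betweenProj cls - withinProj cls := by
  ext x y
  simp [upsilon, betweenProj, withinProj, meanAvg]
  ring

theorem intra_nonneg (Z : Matrix (Fin N) (Fin k) ℝ) : 0 ≤ intra cls Z :=
  Finset.sum_nonneg fun _ _ => Finset.sum_nonneg fun _ _ => sq_nonneg _

theorem upsilon_pos_of_mem_part {Z : Matrix (Fin N) (Fin k) ℝ} (hZ : 0 < inter cls Z)
    {x y : Fin N} (hxy : x ≠ y) (h : y ∈ cls.part x) : 0 < upsilon cls Z x y := by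
  have hη : 0 ≤ eta2 cls Z := div_nonneg (intra_nonneg cls Z) hZ.le
  have hc := card_part_pos cls x
  have hcN : ((cls.part x).card : ℝ) ≤ N := by
    exact_mod_cast (Finset.card_le_univ _).trans_eq (Fintype.card_fin N)
  have h1 : (N : ℝ)⁻¹ ≤ ((cls.part x).card : ℝ)⁻¹ := inv_anti₀ hc hcN
  have h2 := mul_le_mul_of_nonneg_left h1 hη
  have h3 : 0 < ((cls.part x).card : ℝ)⁻¹ := inv_pos.2 hc
  simp only [upsilon, classAvg, Matrix.sub_apply, Matrix.smul_apply, Matrix.of_apply, if_pos h,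
    Matrix.one_apply_ne hxy, smul_eq_mul, div_eq_mul_inv]
  linarith

theorem upsilon_neg_of_notMem_part {Z : Matrix (Fin N) (Fin k) ℝ} (hZ : 0 < inter cls Z)
    (hZ' : 0 < intra cls Z) {x y : Fin N} (h : y ∉ cls.part x) : upsilon cls Z x y < 0 := by
  have hη : 0 < eta2 cls Z := div_pos hZ' hZ
  have hxy : x ≠ y := fun e => h (e ▸ cls.mem_part_self.2 (Finset.mem_univ _))
  have hN : (0 : ℝ) < N := by exact_mod_cast x.pos
  simp only [upsilon, classAvg, Matrix.sub_apply, Matrix.smul_apply, Matrix.of_apply, if_neg h,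
    Matrix.one_apply_ne hxy, smul_eq_mul]
  have := div_pos hη hN
  linarith

end classAvg

end SORL

namespace SORL

/-! ### The perturbed augmentation graph -/

section graph

variable {Xbar : Type*} [MeasurableSpace Xbar] {N : ℕ} {P Pl : Measure Xbar}
  {T : Kernel Xbar (Fin N)} {ηu : ℝ}

theorem labelVec_nonneg (x : Fin N) : 0 ≤ labelVec Pl T x :=
  integral_nonneg fun _ => measureReal_nonneg

theorem sum_labelVec [IsProbabilityMeasure Pl] [IsMarkovKernel T] :
    ∑ x, labelVec Pl T x = 1 := by
  have hint : ∀ x : Fin N, Integrable (fun xb => (T xb).real {x}) Pl := fun x => by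
    refine Integrable.of_bound (C := 1)
      (T.measurable_coe (measurableSet_singleton x)).ennreal_toReal.aestronglyMeasurable ?_
    filter_upwards with xb
    rw [Real.norm_of_nonneg measureReal_nonneg]
    exact measureReal_le_one
  unfold labelVec
  rw [← integral_finsetSum _ fun x _ => hint x]
  have h : ∀ xb, ∑ x : Fin N, (T xb).real {x} = 1 := fun xb => by
    rw [sum_measureReal_singleton]; simp
  simp [h]

theorem adj_eq (δ : ℝ) : adj ηu P Pl T δ
    = adj ηu P Pl T 0 + δ • Matrix.vecMulVec (labelVec Pl T) (labelVec Pl T) := by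
  simp [adj]

theorem degree_adj [IsProbabilityMeasure Pl] [IsMarkovKernel T] (δ : ℝ) (x : Fin N) :
    degree (adj ηu P Pl T δ) x = degree (adj ηu P Pl T 0) x + δ * labelVec Pl T x := by
  rw [adj_eq]
  simp [degree, Finset.sum_add_distrib, Matrix.vecMulVec_apply, ← Finset.mul_sum, sum_labelVec]

theorem adj_zero_nonneg (hdeg : ∀ x, degree (adj ηu P Pl T 0) x = 1) (x y : Fin N) :
    0 ≤ adj ηu P Pl T 0 x y := by
  have hA : ∀ x y, 0 ≤ selfSupAdj P T x y := fun x y =>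
    integral_nonneg fun _ => mul_nonneg measureReal_nonneg measureReal_nonneg
  have h : ηu * ∑ y, selfSupAdj P T x y = 1 := by
    rw [← hdeg x]; simp [degree, adj, Finset.mul_sum]
  have hs : 0 ≤ ∑ y, selfSupAdj P T x y := Finset.sum_nonneg fun y _ => hA x y
  -- The sign of `ηu` is forced by the normalization: its product with a nonnegative row sum is `1`.
  have hη : 0 ≤ ηu := by
    by_contra hη
    nlinarith
  simpa [adj] using mul_nonneg hη (hA x y)

theorem invSqrtDeg_eq_one {A : Matrix (Fin N) (Fin N) ℝ} (hdeg : ∀ x, degree A x = 1) :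
    invSqrtDeg A = 1 := by
  simp [invSqrtDeg, hdeg]

theorem normAdj_eq_self {A : Matrix (Fin N) (Fin N) ℝ} (hdeg : ∀ x, degree A x = 1) :
    normAdj A = A := by
  simp [normAdj, invSqrtDeg_eq_one hdeg]

/-- A symmetric stochastic matrix has eigenvalues at most `1`. -/
theorem eigenvalue_le_one {A V : Matrix (Fin N) (Fin N) ℝ} {σ : Fin N → ℝ} (hV : Vᵀ * V = 1)
    (hA : A = spec V σ) (h0 : ∀ x y, 0 ≤ A x y) (hdeg : ∀ x, degree A x = 1) (j : Fin N) :
    σ j ≤ 1 := by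
  have hsym : ∀ x y, A x y = A y x := fun x y => by
    conv_lhs => rw [hA, ← spec_transpose, Matrix.transpose_apply, ← hA]
  set v : Fin N → ℝ := V *ᵥ Pi.single j 1 with hv
  have hVv : Vᵀ *ᵥ v = Pi.single j 1 := by rw [hv, Matrix.mulVec_mulVec, hV, Matrix.one_mulVec]
  have h1 : v ⬝ᵥ A *ᵥ v = σ j := by
    rw [hA, dotProduct_spec_mulVec, hVv]
    simp [Pi.single_apply]
  have h2 : v ⬝ᵥ v = 1 := by
    rw [dotProduct_self_eq_sum hV, hVv]
    simp [Pi.single_apply]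
  have h3 : v ⬝ᵥ A *ᵥ v = ∑ x, ∑ y, A x y * (v x * v y) := by
    simp only [dotProduct, Matrix.mulVec, Finset.mul_sum]
    exact Finset.sum_congr rfl fun x _ => Finset.sum_congr rfl fun y _ => by ring
  have h4 : ∑ x, ∑ y, A x y * (v x ^ 2) = v ⬝ᵥ v := by
    simp only [← Finset.sum_mul, dotProduct]
    refine Finset.sum_congr rfl fun x _ => ?_
    rw [show ∑ y, A x y = 1 from hdeg x]; ring
  have h5 : ∑ x, ∑ y, A x y * (v y ^ 2) = v ⬝ᵥ v := by
    rw [Finset.sum_comm, ← h4]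
    exact Finset.sum_congr rfl fun x _ => Finset.sum_congr rfl fun y _ => by rw [hsym]
  -- This is `∑ A x y (v x - v y)² ≥ 0`, the nonnegativity of the graph Laplacian.
  have h6 : 2 * ∑ x, ∑ y, A x y * (v x * v y)
      ≤ ∑ x, ∑ y, A x y * (v x ^ 2) + ∑ x, ∑ y, A x y * (v y ^ 2) := by
    simp only [Finset.mul_sum, ← Finset.sum_add_distrib]
    refine Finset.sum_le_sum fun x _ => Finset.sum_le_sum fun y _ => ?_
    nlinarith [mul_nonneg (h0 x y) (sq_nonneg (v x - v y))]
  linarith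

end graph

/-! ### Perturbation of the Gram matrix -/

open scoped Matrix.Norms.L2Operator

/-- `𝔩 𝔩ᵀ` squares to `‖𝔩‖²` times itself, and a probability vector has `‖𝔩‖² ≤ 1`. -/
theorem norm_vecMulVec_self_le_one {N : ℕ} {l : Fin N → ℝ} (h0 : ∀ x, 0 ≤ l x)
    (h1 : ∑ x, l x = 1) : ‖Matrix.vecMulVec l l‖ ≤ 1 := by
  have hle : ∀ x, l x ≤ 1 := fun x => by
    rw [← h1]; exact Finset.single_le_sum (fun i _ => h0 i) (Finset.mem_univ x)
  have hll : l ⬝ᵥ l ≤ 1 := by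
    rw [← h1]
    exact Finset.sum_le_sum fun x _ => by nlinarith [h0 x, hle x]
  have hll0 : 0 ≤ l ⬝ᵥ l := Finset.sum_nonneg fun x _ => mul_self_nonneg _
  have h := norm_transpose_mul_self_eq (Matrix.vecMulVec l l)
  have h2 : (Matrix.vecMulVec l l)ᵀ * Matrix.vecMulVec l l
      = (l ⬝ᵥ l) • Matrix.vecMulVec l l := by
    rw [Matrix.transpose_vecMulVec, Matrix.vecMulVec_mul_vecMulVec]
    ext i j; simp [Matrix.vecMulVec_apply]; ring
  rw [h2, norm_smul, Real.norm_of_nonneg hll0] at h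
  nlinarith [norm_nonneg (Matrix.vecMulVec l l)]

/-- The derivative at `0` of the Gram matrix of the representation when the eigenvalues after the
`k`-th vanish. -/
noncomputable def gramDeriv {N : ℕ} (k : ℕ) (V : Matrix (Fin N) (Fin N) ℝ) (σ l : Fin N → ℝ) :
    Matrix (Fin N) (Fin N) ℝ :=
  Matrix.vecMulVec l l - botProj k V * Matrix.vecMulVec l l * botProj k V
    - (Matrix.diagonal l * (spec V fun i => if (i : ℕ) < k then σ i else 0)
      + (spec V fun i => if (i : ℕ) < k then σ i else 0) * Matrix.diagonal l)

section perturbation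

variable {N k : ℕ} {V V' : Matrix (Fin N) (Fin N) ℝ} {σ σ' : Fin N → ℝ}

/-- Writing the truncation as `M - q M q` reduces its perturbation to those of `M` and `q`, with no
tracking of individual eigenvectors. -/
theorem spec_top_eq_sub (hV : Vᵀ * V = 1) (k : ℕ) (σ : Fin N → ℝ) :
    (spec V fun i => if (i : ℕ) < k then σ i else 0)
      = spec V σ - botProj k V * spec V σ * botProj k V := by
  rw [eq_sub_iff_add_eq, botProj, spec_mul hV, spec_mul hV, spec_add]
  congr 1; ext i; split_ifs <;> simp

theorem norm_botProj_sub_le (hV : Vᵀ * V = 1) (hV' : V'ᵀ * V' = 1) {r : ℝ}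
    (h1 : ‖botProj k V' * topProj k V‖ ≤ r) (h2 : ‖botProj k V * topProj k V'‖ ≤ r) :
    ‖botProj k V' - botProj k V‖ ≤ 2 * r := by
  have h3 : ‖topProj k V' * botProj k V‖ ≤ r := by
    rw [← norm_transpose_eq, Matrix.transpose_mul, topProj, botProj, spec_transpose,
      spec_transpose]
    exact h2
  -- Inserting `p + q = 1` and `p' + q' = 1` cancels `q' q` and leaves only the off-diagonal
  -- products that Davis–Kahan controls.
  have h : botProj k V' - botProj k V
      = botProj k V' * topProj k V - topProj k V' * botProj k V := by
    have e := topProj_add_botProj hV k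
    have e' := topProj_add_botProj hV' k
    calc botProj k V' - botProj k V
        = botProj k V' * (topProj k V + botProj k V)
          - (topProj k V' + botProj k V') * botProj k V := by rw [e, e']; simp
      _ = _ := by noncomm_ring
  rw [h]
  exact (norm_sub_le_of_le h1 h3).trans_eq (by ring)

/-- Since `x = p x p`, one small factor `q' p` appears on each side of `x`, which makes the bound
quadratic. -/
theorem norm_botProj_mul_spec_mul_botProj_le (hV : Vᵀ * V = 1) (hσ0 : ∀ i, 0 ≤ σ i)
    (hσ1 : ∀ i, σ i ≤ 1) {r : ℝ} (h1 : ‖botProj k V' * topProj k V‖ ≤ r) :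
    ‖botProj k V' * (spec V fun i => if (i : ℕ) < k then σ i else 0) * botProj k V'‖
      ≤ r ^ 2 := by
  have h3 : ‖topProj k V * botProj k V'‖ ≤ r := by
    rw [← norm_transpose_eq, Matrix.transpose_mul, topProj, botProj, spec_transpose,
      spec_transpose]
    exact h1
  have h4 : ‖spec V fun i => if (i : ℕ) < k then σ i else 0‖ ≤ 1 :=
    norm_spec_le hV zero_le_one fun i => by
      split_ifs
      · rw [abs_of_nonneg (hσ0 i)]; exact hσ1 i
      · simp
  have h5 : (spec V fun i => if (i : ℕ) < k then σ i else 0)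
      = topProj k V * (spec V fun i => if (i : ℕ) < k then σ i else 0) * topProj k V := by
    rw [topProj, spec_mul hV, spec_mul hV]
    congr 1; ext i; split_ifs <;> simp
  rw [h5]
  calc _ = ‖(botProj k V' * topProj k V) * (spec V fun i => if (i : ℕ) < k then σ i else 0)
        * (topProj k V * botProj k V')‖ := by simp only [Matrix.mul_assoc]
    _ ≤ r * 1 * r := norm_mul_le_of_le (norm_mul_le_of_le h1 h4) h3
    _ = r ^ 2 := by ring

/-- The first estimate is free of `ε` and controls the size of the change; the second identifies its
linear part up to the discarded spectrum. The normalized matrix moves by at most `3 * δ`: `2 * δ`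
from rescaling and `δ` from `δ 𝔩 𝔩ᵀ`. -/
theorem gram_perturbation (hV : Vᵀ * V = 1) (hV' : V'ᵀ * V' = 1) (hσ : Antitone σ)
    (hσ' : Antitone σ') (hσ0 : ∀ i, 0 ≤ σ i) (hσ'0 : ∀ i, 0 ≤ σ' i) (hσ1 : ∀ i, σ i ≤ 1)
    {a ε g δ : ℝ} (hg : 0 < g) (hε : 0 ≤ ε) (hgap : g ≤ a - ε)
    (hlow : ∀ i : Fin N, (i : ℕ) < k → a ≤ σ i) (hhigh : ∀ i : Fin N, k ≤ (i : ℕ) → σ i ≤ ε)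
    (hδ0 : 0 ≤ δ) (hδ : 6 * δ ≤ g) {l : Fin N → ℝ} (hl0 : ∀ x, 0 ≤ l x) (hl : ∑ x, l x = 1)
    {S : Matrix (Fin N) (Fin N) ℝ} (hS : S = Matrix.diagonal fun x => (√(1 + δ * l x))⁻¹)
    (hM : S * (spec V σ + δ • Matrix.vecMulVec l l) * S = spec V' σ') :
    ‖S * (spec V' fun i => if (i : ℕ) < k then σ' i else 0) * S
        - spec V fun i => if (i : ℕ) < k then σ i else 0‖ ≤ (8 + 4 * (6 / g)) * δ ∧
    ‖S * (spec V' fun i => if (i : ℕ) < k then σ' i else 0) * S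
        - (spec V fun i => if (i : ℕ) < k then σ i else 0) - δ • gramDeriv k V σ l‖
      ≤ 2 * ε + (21 + 8 * (6 / g) + (6 / g) ^ 2) * δ ^ 2 := by
  have hl1 : ∀ x, l x ≤ 1 := fun x => by
    rw [← hl]; exact Finset.single_le_sum (fun i _ => hl0 i) (Finset.mem_univ x)
  have hδl : ∀ x, 0 ≤ δ * l x := fun x => mul_nonneg hδ0 (hl0 x)
  have hδl' : ∀ x, δ * l x ≤ δ := fun x => mul_le_of_le_one_right hδ0 (hl1 x)
  have hSn : ‖S‖ ≤ 1 := by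
    rw [hS]; exact norm_diagonal_le zero_le_one fun x => (abs_inv_sqrt_bounds (hδl x)).1
  have hS1 : ‖S - 1‖ ≤ δ := by
    rw [hS, ← Matrix.diagonal_one, Matrix.diagonal_sub]
    exact norm_diagonal_le hδ0 fun x => (abs_inv_sqrt_bounds (hδl x)).2.1.trans (hδl' x)
  have hS2 : ‖S - 1 + (δ / 2) • Matrix.diagonal l‖ ≤ δ ^ 2 := by
    rw [hS, ← Matrix.diagonal_one, Matrix.diagonal_sub, ← Matrix.diagonal_smul,
      Matrix.diagonal_add]
    refine norm_diagonal_le (sq_nonneg δ) fun x => ?_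
    have h := (abs_inv_sqrt_bounds (hδl x)).2.2
    have h' : δ * l x / 2 = (δ / 2) * l x := by ring
    rw [h'] at h
    exact h.trans (pow_le_pow_left₀ (hδl x) (hδl' x) 2)
  have hL : ‖(δ / 2) • Matrix.diagonal l‖ ≤ δ / 2 := by
    rw [norm_smul, Real.norm_of_nonneg (by positivity)]
    refine mul_le_of_le_one_right (by positivity) (norm_diagonal_le zero_le_one fun x => ?_)
    rw [abs_of_nonneg (hl0 x)]; exact hl1 x
  have hb : ‖δ • Matrix.vecMulVec l l‖ ≤ δ := by
    rw [norm_smul, Real.norm_of_nonneg hδ0]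
    exact mul_le_of_le_one_right hδ0 (norm_vecMulVec_self_le_one hl0 hl)
  set x := spec V fun i => if (i : ℕ) < k then σ i else 0 with hx
  set r := spec V fun i => if (i : ℕ) < k then 0 else σ i with hr
  have hxr : x + r = spec V σ := by
    rw [hx, hr, spec_add]; congr 1; ext i; split_ifs <;> simp
  have hxn : ‖x‖ ≤ 1 := norm_spec_le hV zero_le_one fun i => by
    split_ifs
    · rw [abs_of_nonneg (hσ0 i)]; exact hσ1 i
    · simp
  have hrn : ‖r‖ ≤ ε := norm_spec_le hV hε fun i => by
    split_ifs with h
    · simpa using hε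
    · rw [abs_of_nonneg (hσ0 i)]; exact hhigh i (not_lt.1 h)
  have hxrn : ‖x + r‖ ≤ 1 := by
    rw [hxr]
    exact norm_spec_le hV zero_le_one fun i => by rw [abs_of_nonneg (hσ0 i)]; exact hσ1 i
  have hE : ‖spec V' σ' - spec V σ‖ ≤ 3 * δ := by
    have h : spec V' σ' - spec V σ = (S * spec V σ * S - spec V σ)
        + S * (δ • Matrix.vecMulVec l l) * S := by rw [← hM]; noncomm_ring
    rw [h]
    refine (norm_add_le_of_le (norm_sandwich_sub_self_le hSn norm_one_le hS1 (hxr ▸ hxrn))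
      (norm_sandwich_le hSn hb)).trans_eq (by ring)
  have hE' : ‖spec V σ - spec V' σ'‖ ≤ 3 * δ := by rwa [norm_sub_rev]
  have hlow' : ∀ i : Fin N, (i : ℕ) < k → a - 3 * δ ≤ σ' i := fun i hi => by
    have := eigenvalue_le_add_norm hV' hV hσ' hσ i
    linarith [hlow i hi]
  have hhigh' : ∀ i : Fin N, k ≤ (i : ℕ) → σ' i ≤ ε + 3 * δ := fun i hi => by
    have := eigenvalue_le_add_norm hV hV' hσ hσ' i
    linarith [hhigh i hi]
  -- Weyl moves the relevant eigenvalues by at most `3 * δ ≤ g / 2`, so half of the gap `g` remains;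
  -- dividing `3 * δ` by `g / 2` gives the constant `6 / g`.
  have hsin : ∀ {t d : ℝ}, 0 ≤ t → g / 2 ≤ d → d * t ≤ 3 * δ → t ≤ 6 / g * δ := by
    intro t d ht hd h
    have h' : g / 2 * t ≤ 3 * δ := (mul_le_mul_of_nonneg_right hd ht).trans h
    rw [div_mul_eq_mul_div, le_div_iff₀ hg]
    linarith
  have hd1 : ‖botProj k V' * topProj k V‖ ≤ 6 / g * δ :=
    hsin (norm_nonneg _) (by linarith) ((norm_botProj_mul_topProj_le hV hV' hσ'0 (a := a)
      (b := ε + 3 * δ) (by linarith) (by linarith) hlow hhigh').trans hE)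
  have hd2 : ‖botProj k V * topProj k V'‖ ≤ 6 / g * δ :=
    hsin (norm_nonneg _) (by linarith) ((norm_botProj_mul_topProj_le hV' hV hσ0 (a := a - 3 * δ)
      (b := ε) (by linarith) hε hlow' hhigh).trans hE')
  have hqq : ‖botProj k V' - botProj k V‖ ≤ 2 * (6 / g) * δ :=
    (norm_botProj_sub_le hV hV' hd1 hd2).trans_eq (by ring)
  have hqx : botProj k V * x = 0 := by
    rw [hx, botProj, spec_mul hV]
    have : (fun i : Fin N => (if (i : ℕ) < k then (0 : ℝ) else 1)
      * (if (i : ℕ) < k then σ i else 0)) = 0 := by ext i; split_ifs <;> simp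
    rw [this]; simp [spec]
  have hxq : x * botProj k V = 0 := by
    have := congrArg Matrix.transpose hqx
    rwa [Matrix.transpose_mul, hx, botProj, spec_transpose, spec_transpose, ← botProj, ← hx,
      Matrix.transpose_zero] at this
  have hG : (spec V' fun i => if (i : ℕ) < k then σ' i else 0)
      = S * (x + r + δ • Matrix.vecMulVec l l) * S
        - botProj k V' * (S * (x + r + δ • Matrix.vecMulVec l l) * S) * botProj k V' := by
    rw [hxr, hM]; exact spec_top_eq_sub hV' k σ'
  have hx' : x = (x + r) - botProj k V * (x + r) * botProj k V := by
    rw [hxr]; exact spec_top_eq_sub hV k σ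
  rw [hG]
  refine ⟨norm_rescaled_truncation_sub_le norm_one_le hSn hS1 hxn hxrn hb (norm_botProj_le hV k)
    (norm_botProj_le hV' k) hqq hx', ?_⟩
  have hK : δ • gramDeriv k V σ l = δ • Matrix.vecMulVec l l
      - botProj k V * (δ • Matrix.vecMulVec l l) * botProj k V
      - 2 * ((δ / 2) • Matrix.diagonal l * x + x * (δ / 2) • Matrix.diagonal l) := by
    rw [gramDeriv, ← hx, two_mul]
    simp only [smul_mul_assoc, mul_smul_comm]
    module
  rw [hK]
  exact norm_rescaled_truncation_second_order_le norm_one_le hSn hS1 hS2 hL hxn hrn hb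
    (norm_botProj_le hV k) (norm_botProj_le hV' k) hqq hqx hxq
    (norm_botProj_mul_spec_mul_botProj_le hV hσ0 hσ1 hd1)

end perturbation

end SORL

namespace SORL

open scoped Matrix.Norms.L2Operator

/-! ### Rank and trace of the first-order term. -/

section traces

variable {N k : ℕ} {V V' : Matrix (Fin N) (Fin N) ℝ} {σ σ' : Fin N → ℝ}

theorem gramDeriv_transpose (k : ℕ) (V : Matrix (Fin N) (Fin N) ℝ) (σ l : Fin N → ℝ) :
    (gramDeriv k V σ l)ᵀ = gramDeriv k V σ l := by
  simp only [gramDeriv, botProj, Matrix.transpose_sub, Matrix.transpose_add, Matrix.transpose_mul,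
    spec_transpose, Matrix.diagonal_transpose, Matrix.transpose_vecMulVec, Matrix.mul_assoc]
  rw [add_comm]

theorem rank_spec_top_le (hk : k ≤ N) :
    (spec V fun i => if (i : ℕ) < k then σ i else 0).rank ≤ k := by
  rw [← rankApprox_eq_spec hk, rankApprox, Matrix.mul_assoc]
  refine (Matrix.rank_mul_le_left _ _).trans ?_
  simpa using Matrix.rank_le_card_width (topVec hk V)

/-- With `q = 1 - p`, the difference `b - q b q` equals `p b + q b p`, so each of the four summands
has a factor of rank at most `k`. -/
theorem rank_gramDeriv_le (hk : k ≤ N) (hV : Vᵀ * V = 1) (σ l : Fin N → ℝ) :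
    (gramDeriv k V σ l).rank ≤ 4 * k := by
  have hx := rank_spec_top_le (V := V) (σ := σ) hk
  have hP := rank_topProj_le hk V
  have h : Matrix.vecMulVec l l - botProj k V * Matrix.vecMulVec l l * botProj k V
      = topProj k V * Matrix.vecMulVec l l
        + botProj k V * Matrix.vecMulVec l l * topProj k V := by
    have e : topProj k V = 1 - botProj k V := eq_sub_of_add_eq (topProj_add_botProj hV k)
    rw [e]; noncomm_ring
  rw [gramDeriv, h]
  refine (rank_sub_le _ _).trans ?_
  have h1 := (rank_add_le (topProj k V * Matrix.vecMulVec l l)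
    (botProj k V * Matrix.vecMulVec l l * topProj k V)).trans
    (add_le_add ((Matrix.rank_mul_le_left _ _).trans hP) ((Matrix.rank_mul_le_right _ _).trans hP))
  have h2 := (rank_add_le (Matrix.diagonal l * spec V fun i => if (i : ℕ) < k then σ i else 0)
    ((spec V fun i => if (i : ℕ) < k then σ i else 0) * Matrix.diagonal l)).trans
    (add_le_add ((Matrix.rank_mul_le_right _ _).trans hx) ((Matrix.rank_mul_le_left _ _).trans hx))
  omega

/-- Against a symmetric `Y` a matrix and its transpose have the same trace. Transposing `q b p` and
`L x` turns the symmetric derivative into the one-sided expression of the theorem. -/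
theorem trace_mul_gramDeriv {Y : Matrix (Fin N) (Fin N) ℝ} (hY : Yᵀ = Y) (hV : Vᵀ * V = 1)
    (k : ℕ) (σ l : Fin N → ℝ) :
    (Y * gramDeriv k V σ l).trace
      = (Y * (topProj k V * Matrix.vecMulVec l l * (1 + botProj k V)
        - (2 : ℝ) • ((spec V fun i => if (i : ℕ) < k then σ i else 0)
          * Matrix.diagonal l))).trace := by
  set x := spec V fun i => if (i : ℕ) < k then σ i else 0 with hx
  set b := Matrix.vecMulVec l l with hb
  set L := Matrix.diagonal l with hL
  set q := botProj k V with hq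
  set p := topProj k V with hp
  have e : p + q = 1 := topProj_add_botProj hV k
  have key : ∀ M : Matrix (Fin N) (Fin N) ℝ, (Y * Mᵀ).trace = (Y * M).trace := fun M => by
    rw [← Matrix.trace_transpose, Matrix.transpose_mul, Matrix.transpose_transpose, hY,
      Matrix.trace_mul_comm]
  have h1 : (L * x)ᵀ = x * L := by
    rw [Matrix.transpose_mul, hx, spec_transpose, hL, Matrix.diagonal_transpose]
  have h2 : (q * b * p)ᵀ = p * b * q := by
    rw [Matrix.transpose_mul, Matrix.transpose_mul, hq, hp, botProj, topProj, spec_transpose,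
      spec_transpose, hb, Matrix.transpose_vecMulVec, Matrix.mul_assoc]
  have h3 : gramDeriv k V σ l = p * b + q * b * p - (L * x + x * L) := by
    rw [gramDeriv, ← hx, ← hb, ← hL, ← hq, eq_sub_of_add_eq e]; noncomm_ring
  have h4 : p * b * (1 + q) - (2 : ℝ) • (x * L) = p * b + p * b * q - (x * L + x * L) := by
    rw [two_smul]; noncomm_ring
  rw [h3, h4]
  simp only [Matrix.mul_sub, Matrix.mul_add, Matrix.trace_sub, Matrix.trace_add]
  rw [← key (L * x), h1, ← key (q * b * p), h2]

theorem mainCoeff_eq (hk : k ≤ N) (cls : Finpartition (Finset.univ : Finset (Fin N)))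
    (hV : Vᵀ * V = 1) {W : Matrix (Fin N) (Fin (N - k)) ℝ} (hW : IsNullBasis (topVec hk V) W)
    (Z : Matrix (Fin N) (Fin k) ℝ) (l : Fin N → ℝ) :
    mainCoeff hk cls Z l V σ W
      = (intra cls Z / inter cls Z * (betweenProj cls * gramDeriv k V σ l).trace
        - (withinProj cls * gramDeriv k V σ l).trace) / inter cls Z := by
  have hY : (upsilon cls Z)ᵀ = upsilon cls Z := by
    rw [upsilon_eq]; simp [betweenProj_transpose, withinProj_transpose]
  rw [mainCoeff, mul_transpose_eq_botProj hk hV hW, topVec_mul_transpose, rankApprox_eq_spec,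
    ← trace_mul_gramDeriv hY hV, upsilon_eq]
  simp only [Matrix.sub_mul, Matrix.smul_mul, Matrix.trace_sub, Matrix.trace_smul, eta1, eta2,
    smul_eq_mul]
  ring

end traces

/-! ### From the Gram matrix to the K-means measure. -/

/-- Second-order expansion of a quotient. -/
theorem abs_quotient_expansion_le {i₀ n₀ i₁ n₁ p q K B δ E e : ℝ} (hB : 0 < B) (hn₀ : 0 < n₀)
    (hn₀B : 1 / n₀ ≤ B) (hi : |i₀| ≤ K) (hn : |n₀| ≤ K) (hδ : 0 ≤ δ)
    (hδE : δ * (2 * B * (E + 1)) ≤ 1) (hE : 0 ≤ E) (hdi : |i₁ - i₀| ≤ E * δ)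
    (hdn : |n₁ - n₀| ≤ E * δ) (hp : |i₁ - i₀ - δ * p| ≤ e) (hq : |n₁ - n₀ - δ * q| ≤ e) :
    0 < n₁ ∧ |(i₀ / n₀ - i₁ / n₁) - δ * ((i₀ / n₀ * q - p) / n₀)|
      ≤ 4 * K * E ^ 2 * B ^ 3 * δ ^ 2 + 2 * K * B ^ 2 * e := by
  have hK : 0 ≤ K := (abs_nonneg _).trans hi
  have he : 0 ≤ e := (abs_nonneg _).trans hp
  have hBn : 1 ≤ B * n₀ := by rwa [div_le_iff₀ hn₀] at hn₀B
  -- `B * n₀ ≥ 1`, and the smallness of `δ` lets the denominator lose at most half of this.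
  have hn₁ : 1 ≤ 2 * B * n₁ := by
    have h := (abs_le.1 hdn).1
    nlinarith [mul_le_mul_of_nonneg_left h hB.le, mul_nonneg hδ hB.le]
  have hn₁0 : 0 < n₁ := by
    by_contra h
    nlinarith
  have hi₁ : 1 / n₁ ≤ 2 * B := by rw [div_le_iff₀ hn₁0]; exact hn₁
  refine ⟨hn₁0, ?_⟩
  -- Exact identity: the first summand is quadratic in the increments, the second is linear in the
  -- remainders of `hp` and `hq`.
  have h : (i₀ / n₀ - i₁ / n₁) - δ * ((i₀ / n₀ * q - p) / n₀)
      = (i₀ * (n₁ - n₀) - n₀ * (i₁ - i₀)) * (n₀ - n₁) * ((1 / n₀) * (1 / n₀) * (1 / n₁))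
        + (i₀ * (n₁ - n₀ - δ * q) - n₀ * (i₁ - i₀ - δ * p)) * ((1 / n₀) * (1 / n₀)) := by
    field_simp; ring
  have h₀ : 0 ≤ 1 / n₀ := by positivity
  have h₁ : 0 ≤ 1 / n₁ := by positivity
  have hbil : ∀ {u v c : ℝ}, |u| ≤ c → |v| ≤ c → |i₀ * u - n₀ * v| ≤ 2 * K * c := by
    intro u v c hu hv
    calc |i₀ * u - n₀ * v| ≤ |i₀ * u| + |n₀ * v| := abs_sub _ _
      _ ≤ K * c + K * c := by
        rw [abs_mul, abs_mul]
        exact add_le_add (mul_le_mul hi hu (abs_nonneg _) hK) (mul_le_mul hn hv (abs_nonneg _) hK)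
      _ = _ := by ring
  have hnn : (1 / n₀) * (1 / n₀) ≤ B * B := mul_le_mul hn₀B hn₀B h₀ hB.le
  have hnnn : (1 / n₀) * (1 / n₀) * (1 / n₁) ≤ B * B * (2 * B) :=
    mul_le_mul hnn hi₁ h₁ (by positivity)
  have hdn' : |n₀ - n₁| ≤ E * δ := by rwa [abs_sub_comm]
  rw [h]
  refine (abs_add_le _ _).trans ?_
  rw [abs_mul _ (1 / n₀ * (1 / n₀) * (1 / n₁)), abs_mul _ (n₀ - n₁),
    abs_mul _ (1 / n₀ * (1 / n₀)), abs_of_nonneg (a := 1 / n₀ * (1 / n₀) * (1 / n₁)) (by positivity),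
    abs_of_nonneg (a := 1 / n₀ * (1 / n₀)) (by positivity)]
  have t1 := mul_le_mul (mul_le_mul (hbil hdn hdi) hdn' (abs_nonneg _) (by positivity)) hnnn
    (by positivity) (by positivity)
  have t2 := mul_le_mul (hbil hq hp) hnn (by positivity) (by positivity)
  calc _ ≤ _ := add_le_add t1 t2
    _ = _ := by ring

/-- What a lower bound on the spectral gap says about the eigenvalues. -/
theorem singVal_bounds_of_spectralGap {N k : ℕ} (hk : k ≤ N) {σ : Fin N → ℝ} (hσ : Antitone σ)
    (hσ0 : ∀ j, 0 ≤ σ j) (hσ1 : ∀ j, σ j ≤ 1) {a G₀ : ℝ} (ha : 0 < a) (hG₀ : 1 < G₀)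
    (hak : a ≤ singVal σ k) (hgap : ENNReal.ofReal G₀ ≤ spectralGap σ k) :
    (∀ i : Fin N, (i : ℕ) < k → singVal σ k ≤ σ i) ∧
    (∀ i : Fin N, k ≤ (i : ℕ) → σ i ≤ singVal σ (k + 1)) ∧
    0 ≤ singVal σ (k + 1) ∧ a * (1 - 1 / G₀) ≤ singVal σ k - singVal σ (k + 1) ∧
    singVal σ (k + 1) ≤ (spectralGap σ k)⁻¹.toReal := by
  -- For `k = 0` the default `singVal σ 0 = 0` contradicts `0 < a ≤ singVal σ k`.
  have hk1 : 1 ≤ k := by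
    by_contra h
    have : singVal σ k = 0 := by rw [singVal, dif_neg]; omega
    linarith
  have hsk : singVal σ k = σ ⟨k - 1, by omega⟩ := by rw [singVal, dif_pos ⟨hk1, hk⟩]
  have hs0 : 0 ≤ singVal σ (k + 1) := by
    rw [singVal]; split_ifs
    · exact hσ0 _
    · exact le_rfl
  have hskp : 0 < singVal σ k := ha.trans_le hak
  have hsk1 : singVal σ k ≤ 1 := by rw [hsk]; exact hσ1 _
  have hG0 : 0 < G₀ := by linarith
  have hmul : G₀ * singVal σ (k + 1) ≤ singVal σ k := by
    rcases hs0.eq_or_lt with h | h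
    · rw [← h]; simpa using hskp.le
    · rw [spectralGap, ← ENNReal.ofReal_div_of_pos h,
        ENNReal.ofReal_le_ofReal_iff (by positivity), le_div_iff₀ h] at hgap
      exact hgap
  refine ⟨fun i hi => ?_, fun i hi => ?_, hs0, ?_, ?_⟩
  · rw [hsk]; exact hσ (Fin.le_def.2 (by simp only; omega))
  · rw [singVal, dif_pos ⟨by omega, by omega⟩]
    exact hσ (Fin.le_def.2 (by simpa using hi))
  · have h1 : singVal σ (k + 1) ≤ singVal σ k * (1 / G₀) := by
      rw [mul_one_div, le_div_iff₀ hG0]; linarith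
    have h2 : 0 ≤ 1 - 1 / G₀ := by
      rw [sub_nonneg, div_le_one hG0]; exact hG₀.le
    nlinarith [mul_le_mul_of_nonneg_right hak h2]
  · have h1 : (spectralGap σ k)⁻¹.toReal = singVal σ (k + 1) / singVal σ k := by
      rw [spectralGap, ENNReal.inv_div (Or.inl ENNReal.ofReal_ne_top)
        (Or.inr (by simpa using hskp)), ENNReal.toReal_div, ENNReal.toReal_ofReal hs0,
        ENNReal.toReal_ofReal hskp.le]
    rw [h1, le_div_iff₀ hskp]
    exact mul_le_of_le_one_right hs0 hsk1

/-- The theorem with explicit constants. The Gram expansion is tested against the two projections by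
traces, and the results are fed into the quotient expansion with `K = k`. -/
theorem kms_rep_perturbation {N k : ℕ} (hk : k ≤ N) {Xbar : Type*} [MeasurableSpace Xbar]
    {P Pl : Measure Xbar} [IsProbabilityMeasure Pl] {T : Kernel Xbar (Fin N)} [IsMarkovKernel T]
    {ηu : ℝ} {cls : Finpartition (Finset.univ : Finset (Fin N))}
    {V : Matrix (Fin N) (Fin N) ℝ} {σ : Fin N → ℝ} {W : Matrix (Fin N) (Fin (N - k)) ℝ}
    {Z : Matrix (Fin N) (Fin k) ℝ} (hdeg : ∀ x, degree (adj ηu P Pl T 0) x = 1)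
    (hsvd : IsSVD (normAdj (adj ηu P Pl T 0)) V σ) (hW : IsNullBasis (topVec hk V) W)
    (hZ : Z = rep hk (adj ηu P Pl T 0) V σ) {a G₀ B : ℝ} (ha : 0 < a) (hG₀ : 1 < G₀) (hB : 0 < B)
    (hak : a ≤ singVal σ k) (hgap : ENNReal.ofReal G₀ ≤ spectralGap σ k)
    (hinter : 0 < inter cls Z) (heta : eta1 cls Z ≤ B) {g E : ℝ} (hg : 0 < g)
    (hgdef : g = a * (1 - 1 / G₀)) (hE : E = 2 * k * (8 + 4 * (6 / g))) {δ : ℝ} (hδ0 : 0 ≤ δ)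
    (hδg : 6 * δ ≤ g) (hδE : δ * (2 * B * (E + 1)) ≤ 1) {Vδ : Matrix (Fin N) (Fin N) ℝ}
    {σδ : Fin N → ℝ} (hsvdδ : IsSVD (normAdj (adj ηu P Pl T δ)) Vδ σδ) :
    0 < inter cls (rep hk (adj ηu P Pl T δ) Vδ σδ) ∧
    |(kms cls Z - kms cls (rep hk (adj ηu P Pl T δ) Vδ σδ))
        - δ * mainCoeff hk cls Z (labelVec Pl T) V σ W|
      ≤ 4 * k * E ^ 2 * B ^ 3 * δ ^ 2 + 2 * k * B ^ 2 * (6 * k *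
        ((2 + (21 + 8 * (6 / g) + (6 / g) ^ 2)) * ((spectralGap σ k)⁻¹.toReal + δ ^ 2))) := by
  have hV := hsvd.orthonormal
  have hA0 : adj ηu P Pl T 0 = spec V σ := by
    rw [← normAdj_eq_self hdeg]; exact hsvd.decomp
  have hσ1 : ∀ j, σ j ≤ 1 := eigenvalue_le_one hV hA0 (adj_zero_nonneg hdeg) hdeg
  obtain ⟨hlow, hhigh, hε0, hgap', hε⟩ := singVal_bounds_of_spectralGap hk hsvd.antitone
    hsvd.nonneg hσ1 ha hG₀ hak hgap
  have hS : invSqrtDeg (adj ηu P Pl T δ)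
      = Matrix.diagonal fun x => (√(1 + δ * labelVec Pl T x))⁻¹ := by
    simp only [invSqrtDeg, degree_adj, hdeg]
  have hM : invSqrtDeg (adj ηu P Pl T δ)
      * (spec V σ + δ • Matrix.vecMulVec (labelVec Pl T) (labelVec Pl T))
      * invSqrtDeg (adj ηu P Pl T δ) = spec Vδ σδ := by
    rw [← hA0, ← adj_eq]; exact hsvdδ.decomp
  obtain ⟨hp1, hp2⟩ := gram_perturbation hV hsvdδ.orthonormal hsvd.antitone hsvdδ.antitone
    hsvd.nonneg hsvdδ.nonneg hσ1 hg hε0 (hgdef ▸ hgap') hlow hhigh hδ0 hδg labelVec_nonneg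
    sum_labelVec hS hM
  set Zδ := rep hk (adj ηu P Pl T δ) Vδ σδ with hZδ
  have hK0 : (spec V fun i => if (i : ℕ) < k then σ i else 0) = Z * Zᵀ := by
    rw [hZ, rep_mul_transpose hk _ V hsvd.nonneg, invSqrtDeg_eq_one hdeg, Matrix.one_mul,
      Matrix.mul_one]
  rw [← rep_mul_transpose hk _ Vδ hsvdδ.nonneg, ← hZδ, hK0] at hp1 hp2
  set D := gramDeriv k V σ (labelVec Pl T) with hD
  have hZZ : ‖Z * Zᵀ‖ ≤ 1 := by
    rw [← hK0]
    refine norm_spec_le hV zero_le_one fun i => ?_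
    split_ifs
    · rw [abs_of_nonneg (hsvd.nonneg i)]; exact hσ1 i
    · simp
  have hsym : ∀ Y : Matrix (Fin N) (Fin k) ℝ, (Y * Yᵀ)ᵀ = Y * Yᵀ := fun Y => by simp
  have hr1 : (Zδ * Zδᵀ - Z * Zᵀ).rank ≤ 2 * k := by
    have := rank_sub_le (Zδ * Zδᵀ) (Z * Zᵀ)
    have := rank_mul_transpose_le Zδ
    have := rank_mul_transpose_le Z
    omega
  -- `2 * k` from the two Gram matrices and `4 * k` from the derivative.
  have hr2 : (Zδ * Zδᵀ - Z * Zᵀ - δ • D).rank ≤ 6 * k := by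
    have h1 := rank_sub_le (Zδ * Zδᵀ - Z * Zᵀ) (δ • D)
    have h2 : (δ • D).rank ≤ D.rank := by
      have h := Matrix.rank_mul_le_right (δ • (1 : Matrix (Fin N) (Fin N) ℝ)) D
      rwa [Matrix.smul_mul, Matrix.one_mul] at h
    have h3 := rank_gramDeriv_le hk hV σ (labelVec Pl T)
    rw [← hD] at h3
    omega
  have hs1 : (Zδ * Zδᵀ - Z * Zᵀ)ᵀ = Zδ * Zδᵀ - Z * Zᵀ := by
    rw [Matrix.transpose_sub, hsym, hsym]
  have hs2 : (Zδ * Zδᵀ - Z * Zᵀ - δ • D)ᵀ = Zδ * Zδᵀ - Z * Zᵀ - δ • D := by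
    rw [Matrix.transpose_sub, hs1, Matrix.transpose_smul, hD, gramDeriv_transpose]
  have hbound : ∀ S : Matrix (Fin N) (Fin N) ℝ, ‖S‖ ≤ 1 →
      |(S * (Z * Zᵀ)).trace| ≤ k ∧
      |(S * (Zδ * Zδᵀ)).trace - (S * (Z * Zᵀ)).trace| ≤ E * δ ∧
      |(S * (Zδ * Zδᵀ)).trace - (S * (Z * Zᵀ)).trace - δ * (S * D).trace|
        ≤ 6 * k * (2 * singVal σ (k + 1) + (21 + 8 * (6 / g) + (6 / g) ^ 2) * δ ^ 2) := by
    intro S hSn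
    refine ⟨?_, ?_, ?_⟩
    · simpa using abs_trace_mul_le hSn (hsym Z) (rank_mul_transpose_le Z) hZZ
    · have := abs_trace_mul_le hSn hs1 hr1 hp1
      rw [Matrix.mul_sub, Matrix.trace_sub] at this
      refine this.trans_eq ?_
      rw [hE]; push_cast; ring
    · have := abs_trace_mul_le hSn hs2 hr2 hp2
      rw [Matrix.mul_sub, Matrix.mul_sub, Matrix.trace_sub, Matrix.trace_sub, Matrix.mul_smul,
        Matrix.trace_smul, smul_eq_mul] at this
      refine this.trans_eq ?_
      push_cast; ring
  obtain ⟨hi, hdi, hdi'⟩ := hbound _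
    (norm_le_one_of_projection (withinProj_transpose cls) (withinProj_mul_self cls))
  obtain ⟨hn, hdn, hdn'⟩ := hbound _
    (norm_le_one_of_projection (betweenProj_transpose cls) (betweenProj_mul_self cls))
  rw [← intra_eq_trace] at hi
  rw [← intra_eq_trace, ← intra_eq_trace] at hdi hdi'
  rw [← inter_eq_trace] at hn
  rw [← inter_eq_trace, ← inter_eq_trace] at hdn hdn'
  have hE0 : 0 ≤ E := by rw [hE]; positivity
  obtain ⟨hpos, hfin⟩ := abs_quotient_expansion_le hB hinter heta hi hn hδ0 hδE hE0 hdi hdn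
    hdi' hdn'
  refine ⟨hpos, ?_⟩
  rw [mainCoeff_eq hk cls hV hW]
  refine hfin.trans (add_le_add le_rfl (mul_le_mul_of_nonneg_left
    (mul_le_mul_of_nonneg_left ?_ (by positivity)) (by positivity)))
  set C : ℝ := 21 + 8 * (6 / g) + (6 / g) ^ 2 with hC
  have hC0 : 0 ≤ C := by positivity
  nlinarith [sq_nonneg δ, mul_nonneg hC0 (hε0.trans hε)]

end SORL

theorem mainTheorem5 (k : ℕ) (a G₀ B : ℝ) (ha : 0 < a) (hG₀ : 1 < G₀) (hB : 0 < B) :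
    ∃ C δ₀ : ℝ, 0 < C ∧ 0 < δ₀ ∧
      ∀ (N : ℕ) (hk : k ≤ N) (Xbar : Type*) [MeasurableSpace Xbar]
        (P Pl : Measure Xbar) [IsProbabilityMeasure P] [IsProbabilityMeasure Pl]
        (T : Kernel Xbar (Fin N)) [IsMarkovKernel T] (ηu : ℝ)
        (cls : Finpartition (Finset.univ : Finset (Fin N)))
        (V : Matrix (Fin N) (Fin N) ℝ) (σ : Fin N → ℝ) (W : Matrix (Fin N) (Fin (N - k)) ℝ)
        (Z : Matrix (Fin N) (Fin k) ℝ),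
        (∀ x, SORL.degree (SORL.adj ηu P Pl T 0) x = 1) →
        SORL.IsSVD (SORL.normAdj (SORL.adj ηu P Pl T 0)) V σ →
        SORL.IsNullBasis (SORL.topVec hk V) W →
        Z = SORL.rep hk (SORL.adj ηu P Pl T 0) V σ →
        a ≤ SORL.singVal σ k →
        ENNReal.ofReal G₀ ≤ SORL.spectralGap σ k →
        0 < SORL.inter cls Z →
        SORL.eta1 cls Z ≤ B →
        (∀ x x', x ≠ x' → x' ∈ cls.part x → 0 < SORL.upsilon cls Z x x') ∧
        (∀ x x', x' ∉ cls.part x → 0 < SORL.intra cls Z → SORL.upsilon cls Z x x' < 0) ∧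
        ∀ δ : ℝ, 0 < δ → δ ≤ δ₀ →
          ∀ (Vδ : Matrix (Fin N) (Fin N) ℝ) (σδ : Fin N → ℝ),
            SORL.IsSVD (SORL.normAdj (SORL.adj ηu P Pl T δ)) Vδ σδ →
            0 < SORL.inter cls (SORL.rep hk (SORL.adj ηu P Pl T δ) Vδ σδ) ∧
            |(SORL.kms cls Z - SORL.kms cls (SORL.rep hk (SORL.adj ηu P Pl T δ) Vδ σδ))
                - δ * SORL.mainCoeff hk cls Z (SORL.labelVec Pl T) V σ W|
              ≤ C * ((SORL.spectralGap σ k)⁻¹.toReal + δ ^ 2) := by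
  have hg : 0 < a * (1 - 1 / G₀) := by
    refine mul_pos ha ?_
    rw [sub_pos, div_lt_one (by linarith)]; exact hG₀
  obtain ⟨g, hgdef⟩ : ∃ g, g = a * (1 - 1 / G₀) := ⟨_, rfl⟩
  obtain ⟨E, hE⟩ : ∃ E : ℝ, E = 2 * k * (8 + 4 * (6 / g)) := ⟨_, rfl⟩
  obtain ⟨C, hC⟩ : ∃ C : ℝ, C = 2 + (21 + 8 * (6 / g) + (6 / g) ^ 2) := ⟨_, rfl⟩
  rw [← hgdef] at hg
  have hE0 : 0 ≤ E := by rw [hE]; positivity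
  have hC0 : 0 ≤ C := by rw [hC]; positivity
  -- The summand `1` makes the constant positive also for `k = 0`. Of the two bounds on `δ`, `g / 6`
  -- keeps the spectral gap open and the other keeps the inter-class measure away from `0`.
  refine ⟨4 * k * E ^ 2 * B ^ 3 + 2 * k * B ^ 2 * (6 * k * C) + 1,
    min (g / 6) (1 / (2 * B * (E + 1))), by positivity, by positivity, ?_⟩
  intro N hk Xbar _ P Pl _ _ T _ ηu cls V σ W Z hdeg hsvd hW hZ hak hgap hinter heta
  refine ⟨fun x x' hne hx => SORL.upsilon_pos_of_mem_part cls hinter hne hx,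
    fun x x' hx hin => SORL.upsilon_neg_of_notMem_part cls hinter hin hx, ?_⟩
  intro δ hδ0 hδ Vδ σδ hsvdδ
  have hδg : 6 * δ ≤ g := by linarith [hδ.trans (min_le_left _ _)]
  have hδE : δ * (2 * B * (E + 1)) ≤ 1 := by
    rw [← le_div_iff₀ (by positivity)]; exact hδ.trans (min_le_right _ _)
  obtain ⟨hpos, hfin⟩ := SORL.kms_rep_perturbation hk hdeg hsvd hW hZ ha hG₀ hB hak hgap hinter
    heta hg hgdef hE hδ0.le hδg hδE hsvdδ
  refine ⟨hpos, hfin.trans ?_⟩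
  rw [← hC]
  have hε : 0 ≤ (SORL.spectralGap σ k)⁻¹.toReal := ENNReal.toReal_nonneg
  have h : 0 ≤ 4 * k * E ^ 2 * B ^ 3 * (SORL.spectralGap σ k)⁻¹.toReal := by positivity
  nlinarith [sq_nonneg δ]
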